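/- A countable Borel equivalence relation (CBER) on a standard Borel space $X$ is an equivalence relation on $X$ that is Borel as a subset of $X^2$ and has countable classes. For a CBER $E$ on $X$, $\mathrm{Aut}_B(E)$ is the group of Borel automorphisms $T$ of $X$ with $x\,E\,y \iff T(x)\,E\,T(y)$, $\mathrm{Inn}_B(E)$ is its normal subgroup of those $T$ with $x\,E\,T(x)$ for all $x$, $\mathrm{Out}_B(E)=\mathrm{Aut}_B(E)/\mathrm{Inn}_B(E)$, and $p_E:\mathrm{Aut}_B(E)\to\mathrm{Out}_B(E)$ is the projection. For CBERs $E\subseteq F$ on $X$, $E$ is normal in $F$ if there is a countable subgroup $G\le\mathrm{Aut}_B(E)$ such that $x\,F\,y \iff \exists T\in G\ (T(x)\,E\,y)$; $E$ has finite index in $F$ if every $F$-class contains only finitely many $E$-classes; and an $(E,F)$-link is a CBER $L\subseteq F$ such that within every $F$-class, every $E$-class meets every $L$-class in exactly one point. An outer action of a countable group $G$ on $X/E$ is a homomorphism $\varphi:G\to\mathrm{Out}_B(E)$; a lift of it is a homomorphism $\psi:G\to\mathrm{Aut}_B(E)$ with $p_E\circ\psi=\varphi$. A homomorphism $\psi: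 G\to\mathrm{Aut}_B(E)$, with $g\cdot x=\psi(g)(x)$, is class-bijective if $g\cdot x\,E\,x$ implies $g\cdot x=x$. A homomorphism $i:H\to G$ of countable groups has the class-bijective lifting property if for every CBER $E$, every class-bijective $\eta:H\to\mathrm{Aut}_B(E)$ and every $\varphi:G\to\mathrm{Out}_B(E)$ with $p_E\circ\eta=\varphi\circ i$, there is a class-bijective lift $\psi:G\to\mathrm{Aut}_B(E)$ of $\varphi$ with $\psi\circ i=\eta$. **Theorem.** (1) Let $E\subseteq F\subseteq F'$ be CBERs on a standard Borel space such that $E$ has finite index in $F'$ and $E$ is normal in $F'$. Then every $(E,F)$-link is contained in an $(E,F')$-link. (2) Every homomorphism of finite groups has the class-bijective lifting property. (3) Every outer action of a countable locally finite group (one all of whose finitely generated subgroups are finite) on $X/E$, for any CBER $E$ on a standard Borel space $X$, has a class-bijective lift. -/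

import Mathlib

universe u v w

namespace CBER

/-- `E` is a countable Borel equivalence relation: it is Borel as a subset of `X × X` and each of
its classes is countable. -/
structure IsCBER {X : Type u} [MeasurableSpace X] (E : Setoid X) : Prop where
  measurableSet_graph : MeasurableSet {p : X × X | E p.1 p.2}
  countable_class : ∀ x : X, {y : X | E x y}.Countable

/-- `Aut_B(E)`: the group of Borel automorphisms `T` of `X` such that `x E y ↔ T x E T y`. -/
def autB {X : Type u} [MeasurableSpace X] (E : Setoid X) : Subgroup (Equiv.Perm X) where
  carrier := {T | Measurable T ∧ Measurable T.symm ∧ ∀ x y, E x y ↔ E (T x) (T y)}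
  one_mem' := ⟨measurable_id, measurable_id, fun _ _ => Iff.rfl⟩
  mul_mem' := by
    rintro S T ⟨hS, hS', hSE⟩ ⟨hT, hT', hTE⟩
    exact ⟨hS.comp hT, hT'.comp hS', fun x y => (hTE x y).trans (hSE (T x) (T y))⟩
  inv_mem' := by
    rintro T ⟨hT, hT', hTE⟩
    refine ⟨hT', hT, fun x y => ?_⟩
    have h := hTE (T.symm x) (T.symm y)
    simp only [Equiv.apply_symm_apply] at h
    exact h.symm

/-- `Inn_B(E)`: the subgroup of those `T` in `Aut_B(E)` with `x E T x` for all `x`. -/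
def innB {X : Type u} [MeasurableSpace X] (E : Setoid X) : Subgroup (autB E) where
  carrier := {T | ∀ x : X, E x (T.1 x)}
  one_mem' := fun x => E.refl' x
  mul_mem' := by
    intro S T hS hT x
    exact E.trans' (hT x) (hS (T.1 x))
  inv_mem' := by
    intro T hT x
    have h := hT (T.1.symm x)
    rw [Equiv.apply_symm_apply] at h
    exact E.symm' h

instance innB_normal {X : Type u} [MeasurableSpace X] (E : Setoid X) : (innB E).Normal where
  conj_mem := by
    intro T hT S x
    have h := (S.2.2.2 _ _).1 (hT (S.1.symm x))
    rw [Equiv.apply_symm_apply] at h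
    exact h

/-- `Out_B(E) = Aut_B(E) / Inn_B(E)`. A morphism `G →* OutB E` is an outer action of `G`. -/
abbrev OutB {X : Type u} [MeasurableSpace X] (E : Setoid X) : Type u := autB E ⧸ innB E

/-- The canonical projection `p_E : Aut_B(E) → Out_B(E)`. -/
abbrev projOut {X : Type u} [MeasurableSpace X] (E : Setoid X) : autB E →* OutB E :=
  QuotientGroup.mk' (innB E)

/-- `E` is normal in `F`: there is a countable subgroup `G` of `Aut_B(E)` with `F = E^{∨G}`, that
is, `x F y` iff some `T` in `G` maps the `E`-class of `x` to the `E`-class of `y`. -/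
def IsNormalIn {X : Type u} [MeasurableSpace X] (E F : Setoid X) : Prop :=
  ∃ G : Subgroup (autB E), Countable G ∧ ∀ x y : X, F x y ↔ ∃ T ∈ G, E (T.1 x) y

/-- `E` has finite index in `F`: every `F`-class contains only finitely many `E`-classes. -/
def HasFiniteIndexIn {X : Type u} (E F : Setoid X) : Prop :=
  ∀ x : X, ((Quotient.mk E) '' {y : X | F x y}).Finite

/-- `L` is an `(E, F)`-link: a CBER contained in `F` such that inside every `F`-class, every
`E`-class meets every `L`-class in exactly one point. -/
structure IsLink {X : Type u} [MeasurableSpace X] (E F L : Setoid X) : Prop where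
  isCBER : IsCBER L
  le : L ≤ F
  existsUnique_mem : ∀ x y : X, F x y → ∃! z : X, E x z ∧ L y z

/-- An action `G → Aut_B(E)` is class-bijective if `g • x E x` implies `g • x = x`. -/
def IsClassBijective {X : Type u} [MeasurableSpace X] {E : Setoid X} {G : Type v} [Group G]
    (ψ : G →* autB E) : Prop :=
  ∀ (g : G) (x : X), E ((ψ g).1 x) x → (ψ g).1 x = x

/-- `ψ` is a lift of the outer action `φ`. -/
def IsLift {X : Type u} [MeasurableSpace X] {E : Setoid X} {G : Type v} [Group G]
    (ψ : G →* autB E) (φ : G →* OutB E) : Prop :=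
  (projOut E).comp ψ = φ

/-- A morphism `i : H → G` has the class-bijective lifting property: whenever an outer action `φ`
of `G` on a CBER `E` and a class-bijective action `η` of `H` satisfy `p_E ∘ η = φ ∘ i`, there is
a class-bijective lift `ψ` of `φ` with `ψ ∘ i = η`. -/
def HasClassBijectiveLifting {H : Type v} {G : Type w} [Group H] [Group G] (i : H →* G) : Prop :=
  ∀ (X : Type u) [MeasurableSpace X] [StandardBorelSpace X] (E : Setoid X), IsCBER E →
    ∀ (η : H →* autB E) (φ : G →* OutB E), (projOut E).comp η = φ.comp i → IsClassBijective η →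
      ∃ ψ : G →* autB E, IsLift ψ φ ∧ ψ.comp i = η ∧ IsClassBijective ψ

/-- A group is locally finite if each of its finitely generated subgroups is finite. -/
def IsLocallyFiniteGroup (G : Type v) [Group G] : Prop :=
  ∀ K : Subgroup G, K.FG → Finite K

end CBER

/-! Everything rests on (1). An `(E, F')`-link containing `L` amounts to a Borel partition into
blocks, a block being an `L`-invariant set made of one `L`-class from each `F`-class of a single
`F'`-class. Since an `F'`-class has finitely many `F`-classes, a countable colouring argument gives
a disjoint Borel family of blocks so large that in each `F'`-class some `F`-class is wholly covered
(`exists_maximal_transversalFamily`).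

Where everything is covered, the link is found. Elsewhere one `F`-class is exhausted and another is
not. Normality carries each `E`-class into both kinds, and matching along blocks then injects the
`E`-class into itself without being onto: `E` is compressible there (`IsLinkOn.exists_compression`).
Iterating the injection produces, in every such `F`-class, infinitely many inequivalent `L`-classes
(`exists_disjoint_sequences`). This is room enough to give every `L`-class a block of its own, all
disjoint, and a Schröder–Bernstein exchange makes the blocks cover
(`IsTransversalFamily.exists_cover`).

Class-bijective lifts are links in disguise: the orbits of such a lift form a link, and a link lets
`g` move `x` to the point of the `E`-class `φ(g)[x]` that is linked to `x`. So (2) is (1) for the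
relations generated by `E` with `φ ∘ i` and with `φ`, and (3) takes the union of links extended
along a chain of finite subgroups. Borelness throughout comes from Lusin–Novikov. -/

open Set Filter Topology MeasureTheory

namespace CBER

/-! ### Thin sets, thick families and a Cantor scheme inside a fibre -/

section LusinNovikov

/-- A Borel set is `f`-thin if it is covered by countably many Borel sets on which `f` is
injective. -/
def IsThin {X Y : Type*} [MeasurableSpace X] (f : X → Y) (B : Set X) : Prop :=
  MeasurableSet B ∧ ∃ C : ℕ → Set X, (∀ n, MeasurableSet (C n) ∧ InjOn f (C n)) ∧ B ⊆ ⋃ n, C n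

theorem IsThin.iUnion {X Y ι : Type*} [MeasurableSpace X] [Countable ι] {f : X → Y}
    {B : ι → Set X} (h : ∀ i, IsThin f (B i)) : IsThin f (⋃ i, B i) := by
  refine ⟨MeasurableSet.iUnion fun i => (h i).1, ?_⟩
  cases isEmpty_or_nonempty ι
  · exact ⟨fun _ => ∅, by simp, by simp⟩
  choose C hC hBC using fun i => (h i).2
  obtain ⟨e, he⟩ := exists_surjective_nat (ι × ℕ)
  refine ⟨fun n => C (e n).1 (e n).2, fun n => hC _ _, ?_⟩
  refine iUnion_subset fun i x hx => ?_
  obtain ⟨m, hm⟩ := mem_iUnion.1 (hBC i hx)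
  obtain ⟨n, hn⟩ := he (i, m)
  exact mem_iUnion.2 ⟨n, by simpa [hn] using hm⟩

theorem IsThin.of_injOn {X Y : Type*} [MeasurableSpace X] {f : X → Y} {B : Set X}
    (hB : MeasurableSet B) (hf : InjOn f B) : IsThin f B :=
  ⟨hB, fun _ => B, fun _ => ⟨hB, hf⟩, fun _ hx => mem_iUnion.2 ⟨0, hx⟩⟩

theorem IsThin.union {X Y : Type*} [MeasurableSpace X] {f : X → Y} {B C : Set X}
    (hB : IsThin f B) (hC : IsThin f C) : IsThin f (B ∪ C) := by
  rw [union_eq_iUnion]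
  exact IsThin.iUnion (by rintro (_ | _) <;> assumption)

theorem isThin_empty {X Y : Type*} [MeasurableSpace X] (f : X → Y) : IsThin f ∅ :=
  IsThin.of_injOn MeasurableSet.empty (injOn_empty f)

theorem analyticSet_inter {X : Type*} [TopologicalSpace X] [T2Space X] {A B : Set X}
    (hA : AnalyticSet A) (hB : AnalyticSet B) : AnalyticSet (A ∩ B) := by
  rw [inter_eq_iInter]
  exact AnalyticSet.iInter (by rintro (_ | _) <;> assumption)

variable {X Y : Type*} [MetricSpace X] [CompleteSpace X] [SecondCountableTopology X]
  [MeasurableSpace X] [BorelSpace X] [TopologicalSpace Y] [T2Space Y]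

theorem analyticSet_collision {f : X → Y} (hf : Continuous f) {A : Set X} (hA : AnalyticSet A) :
    AnalyticSet {x | ∃ x' ∈ A, f x' = f x ∧ x' ≠ x} := by
  have h1 : AnalyticSet (Prod.fst ⁻¹' A : Set (X × X)) := hA.preimage continuous_fst
  have h2 : MeasurableSet {p : X × X | f p.1 = f p.2 ∧ p.1 ≠ p.2} := by
    apply MeasurableSet.inter
    · exact (isClosed_eq (hf.comp continuous_fst) (hf.comp continuous_snd)).measurableSet
    · exact (isClosed_eq continuous_fst continuous_snd).measurableSet.compl
  have h3 := (analyticSet_inter h1 h2.analyticSet).image_of_continuous continuous_snd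
  convert h3 using 1
  ext x
  constructor
  · rintro ⟨x', h, h'⟩
    exact ⟨(x', x), ⟨h, h'⟩, rfl⟩
  · rintro ⟨⟨x', _⟩, ⟨h, h'⟩, rfl⟩
    exact ⟨x', h, h'⟩

/-- An analytic set on which `f` is injective is contained in a Borel set on which `f` is
injective. -/
theorem exists_measurableSet_superset_injOn {f : X → Y} (hf : Continuous f) {A : Set X}
    (hA : AnalyticSet A) (hfA : InjOn f A) :
    ∃ C, A ⊆ C ∧ MeasurableSet C ∧ InjOn f C := by
  -- `C` contains no point colliding with `A`, but may contain collisions of its own. By symmetry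
  -- `A` contains no point colliding with `C`, so a second separation removes those.
  obtain ⟨C, hAC, hC, hCm⟩ := hA.measurablySeparable (analyticSet_collision hf hA) (by
    rw [disjoint_left]
    rintro x hx ⟨x', hx', h, h'⟩
    exact h' (hfA hx' hx h))
  obtain ⟨D, hAD, hD, hDm⟩ := hA.measurablySeparable (analyticSet_collision hf hCm.analyticSet) (by
    rw [disjoint_left]
    rintro x hx ⟨x', hx', h, h'⟩
    exact disjoint_left.1 hC ⟨x, hx, h.symm, h'.symm⟩ hx')
  refine ⟨C ∩ D, subset_inter hAC hAD, hCm.inter hDm, fun x hx y hy h => ?_⟩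
  by_contra hne
  exact disjoint_left.1 hD ⟨x, hx.1, h, hne⟩ hy.2

/-- A family of sets is `f`-thick if off every thin set some fibre of `f` meets all its members. -/
def IsThick (f : X → Y) (𝓤 : Set (Set X)) : Prop :=
  ∀ B, IsThin f B → ∃ y, ∀ U ∈ 𝓤, ∃ x ∈ U, x ∉ B ∧ f x = y

/-- If every pair of small disjoint balls failed, countably many thin sets would witness it. Off
their union, the points of `U` whose fibre still meets every member of the family form an analytic
set on which `f` is injective. That set is thus thin up to a Borel superset, against thickness. -/
theorem IsThick.exists_split {f : X → Y} (hf : Continuous f) {𝓤 : Set (Set X)} (hfin : 𝓤.Finite)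
    (hcl : ∀ U ∈ 𝓤, IsClosed U) (h : IsThick f 𝓤) {U : Set X} (hU : U ∈ 𝓤) {ε : ℝ} (hε : 0 < ε) :
    ∃ V : Bool → Set X, (∀ b, IsClosed (V b) ∧ V b ⊆ U ∧ ∀ x ∈ V b, ∀ y ∈ V b, dist x y ≤ ε) ∧
      Disjoint (V false) (V true) ∧ IsThick f (𝓤 ∪ range V) := by
  by_contra hcon
  obtain ⟨x₀, -⟩ : ∃ x : X, True := by
    obtain ⟨y, hy⟩ := h ∅ (isThin_empty f)
    obtain ⟨x, -⟩ := hy U hU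
    exact ⟨x, trivial⟩
  have : Nonempty X := ⟨x₀⟩
  set d := TopologicalSpace.denseSeq X
  set r : ℕ → ℝ := fun n => min (ε / 2) (1 / (n + 1 : ℝ))
  set V : ℕ × ℕ × ℕ → Bool → Set X := fun i b =>
    U ∩ Metric.closedBall (d (bif b then i.1 else i.2.1)) (r i.2.2)
  have hV : ∀ i, ∃ B, IsThin f B ∧ (Disjoint (V i false) (V i true) →
      ¬ ∃ y, ∀ W ∈ 𝓤 ∪ range (V i), ∃ x ∈ W, x ∉ B ∧ f x = y) := by
    intro i
    by_cases hd : Disjoint (V i false) (V i true)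
    · have : ¬ IsThick f (𝓤 ∪ range (V i)) := by
        intro ht
        refine hcon ⟨V i, fun b => ⟨(hcl U hU).inter Metric.isClosed_closedBall,
          inter_subset_left, ?_⟩, hd, ht⟩
        rintro x ⟨-, hx⟩ y ⟨-, hy⟩
        have h1 := Metric.mem_closedBall.1 hx
        have h2 := Metric.mem_closedBall'.1 hy
        have h3 : r i.2.2 ≤ ε / 2 := min_le_left _ _
        linarith [dist_triangle x (d (bif b then i.1 else i.2.1)) y]
      simp only [IsThick, not_forall] at this
      obtain ⟨B, hB, hB'⟩ := this
      exact ⟨B, hB, fun _ => hB'⟩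
    · exact ⟨∅, isThin_empty f, fun h => absurd h hd⟩
  choose B hB hBV using hV
  have hBt := IsThin.iUnion hB
  set C : Set X := ⋂ W : 𝓤, (U \ ⋃ i, B i) ∩ f ⁻¹' (f '' (W.1 \ ⋃ i, B i))
  have hCan : AnalyticSet C := by
    have : Nonempty 𝓤 := ⟨⟨U, hU⟩⟩
    have : Countable 𝓤 := hfin.countable
    refine AnalyticSet.iInter fun W => analyticSet_inter ?_ ?_
    · exact ((hcl U hU).measurableSet.diff hBt.1).analyticSet
    · exact ((((hcl W W.2).measurableSet.diff hBt.1).analyticSet).image_of_continuous hf).preimage hf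
  have hCinj : InjOn f C := by
    intro x hx x' hx' hxx
    by_contra hne
    have hpos : 0 < dist x x' := dist_pos.2 hne
    obtain ⟨n, hn⟩ := exists_nat_one_div_lt (show (0 : ℝ) < dist x x' / 4 by linarith)
    have hr : 0 < r n := lt_min (by linarith) (by positivity)
    have hr' : r n < dist x x' / 4 := lt_of_le_of_lt (min_le_right _ _) hn
    obtain ⟨a, ha⟩ := (TopologicalSpace.denseRange_denseSeq X).exists_dist_lt x hr
    obtain ⟨b, hb⟩ := (TopologicalSpace.denseRange_denseSeq X).exists_dist_lt x' hr
    refine hBV (a, b, n) ?_ ⟨f x, ?_⟩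
    · rw [disjoint_left]
      rintro z ⟨-, hz⟩ ⟨-, hz'⟩
      have h1 := Metric.mem_closedBall.1 hz
      have h2 := Metric.mem_closedBall.1 hz'
      simp only [cond_false, cond_true] at h1 h2
      have := dist_triangle4 x (d a) z x'
      have := dist_triangle z (d b) x'
      rw [dist_comm] at h2
      rw [dist_comm x'] at hb
      have h4 := dist_comm z (d b)
      linarith
    · have hxC := mem_iInter.1 hx
      have hxC' := mem_iInter.1 hx'
      have hsub : ∀ z, z ∉ ⋃ i, B i → z ∉ B (a, b, n) := fun z hz hz' =>
        hz (mem_iUnion.2 ⟨_, hz'⟩)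
      rintro W (hW | ⟨c, rfl⟩)
      · obtain ⟨z, hz, hzx⟩ := (hxC ⟨W, hW⟩).2
        exact ⟨z, hz.1, hsub z hz.2, hzx⟩
      · cases c
        · exact ⟨x', ⟨(hxC' ⟨U, hU⟩).1.1, hb.le⟩, hsub _ (hxC' ⟨U, hU⟩).1.2, hxx.symm⟩
        · exact ⟨x, ⟨(hxC ⟨U, hU⟩).1.1, ha.le⟩, hsub _ (hxC ⟨U, hU⟩).1.2, rfl⟩
  obtain ⟨D, hCD, hD, hDinj⟩ := exists_measurableSet_superset_injOn hf hCan hCinj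
  obtain ⟨y, hy⟩ := h _ (hBt.union (IsThin.of_injOn hD hDinj))
  obtain ⟨x, hxU, hx, hxy⟩ := hy U hU
  refine hx (Or.inr (hCD (mem_iInter.2 fun W => ⟨⟨hxU, fun h' => hx (Or.inl h')⟩, ?_⟩)))
  obtain ⟨z, hzW, hz, hzy⟩ := hy W W.2
  exact ⟨z, ⟨hzW, fun h' => hz (Or.inl h')⟩, hzy.trans hxy.symm⟩

theorem IsThick.exists_split_all {f : X → Y} (hf : Continuous f) {ε : ℝ} (hε : 0 < ε)
    {𝓤 : Set (Set X)} (hfin : 𝓤.Finite) (hcl : ∀ U ∈ 𝓤, IsClosed U) (h : IsThick f 𝓤) :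
    ∃ 𝓥 : Set (Set X), 𝓥.Finite ∧ (∀ U ∈ 𝓥, IsClosed U) ∧ IsThick f 𝓥 ∧ ∀ U ∈ 𝓤,
      ∃ V : Bool → Set X, (∀ b, V b ∈ 𝓥 ∧ V b ⊆ U ∧ ∀ x ∈ V b, ∀ y ∈ V b, dist x y ≤ ε) ∧
        Disjoint (V false) (V true) := by
  suffices H : ∀ 𝓣 : Set (Set X), 𝓣.Finite → 𝓣 ⊆ 𝓤 →
      ∃ 𝓥 : Set (Set X), 𝓤 ⊆ 𝓥 ∧ 𝓥.Finite ∧ (∀ U ∈ 𝓥, IsClosed U) ∧ IsThick f 𝓥 ∧ ∀ U ∈ 𝓣,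
      ∃ V : Bool → Set X, (∀ b, V b ∈ 𝓥 ∧ V b ⊆ U ∧ ∀ x ∈ V b, ∀ y ∈ V b, dist x y ≤ ε) ∧
        Disjoint (V false) (V true) by
    obtain ⟨𝓥, -, h'⟩ := H 𝓤 hfin subset_rfl
    exact ⟨𝓥, h'⟩
  intro 𝓣 h𝓣
  induction 𝓣, h𝓣 using Set.Finite.induction_on with
  | empty => exact fun _ => ⟨𝓤, subset_rfl, hfin, hcl, h, by simp⟩
  | @insert U 𝓣 _ _ ih =>
    intro hsub
    obtain ⟨𝓥, h1, h2, h3, h4, h5⟩ := ih ((subset_insert _ _).trans hsub)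
    obtain ⟨V, hV, hVd, hVt⟩ := h4.exists_split hf h2 h3 (h1 (hsub (mem_insert _ _))) hε
    refine ⟨𝓥 ∪ range V, h1.trans subset_union_left, h2.union (finite_range V), ?_, hVt, ?_⟩
    · rintro W (hW | ⟨b, rfl⟩)
      exacts [h3 W hW, (hV b).1]
    · rintro W (rfl | hW)
      · exact ⟨V, fun b => ⟨Or.inr (mem_range_self b), (hV b).2⟩, hVd⟩
      · obtain ⟨V', hV', hd⟩ := h5 W hW
        exact ⟨V', fun b => ⟨Or.inl (hV' b).1, (hV' b).2⟩, hd⟩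

/-- If the whole space is `f`-thick, then some fibre of `f` contains a copy of Cantor space. -/
theorem IsThick.exists_injective {f : X → Y} (hf : Continuous f) (h : IsThick f {univ}) :
    ∃ x : (ℕ → Bool) → X, Function.Injective x ∧ ∀ α β, f (x α) = f (x β) := by
  let S := {𝓤 : Set (Set X) // 𝓤.Finite ∧ (∀ U ∈ 𝓤, IsClosed U) ∧ IsThick f 𝓤}
  have step : ∀ (n : ℕ) (𝓤 : S), ∃ 𝓥 : S, ∀ U ∈ 𝓤.1, ∃ V : Bool → Set X,
      (∀ b, V b ∈ 𝓥.1 ∧ V b ⊆ U ∧ ∀ x ∈ V b, ∀ y ∈ V b, dist x y ≤ 1 / (n + 1 : ℝ)) ∧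
        Disjoint (V false) (V true) := by
    rintro n ⟨𝓤, h1, h2, h3⟩
    obtain ⟨𝓥, h4, h5, h6, h7⟩ := h3.exists_split_all hf (Nat.one_div_pos_of_nat (n := n)) h1 h2
    exact ⟨⟨𝓥, h4, h5, h6⟩, h7⟩
  choose next hnext using step
  let T : ℕ → S := fun n => Nat.rec ⟨{univ}, finite_singleton _, by simp, h⟩ (fun n 𝓤 => next n 𝓤) n
  have hT : ∀ n, ∀ U ∈ (T n).1, ∃ V : Bool → Set X,
      (∀ b, V b ∈ (T (n + 1)).1 ∧ V b ⊆ U ∧ ∀ x ∈ V b, ∀ y ∈ V b, dist x y ≤ 1 / (n + 1 : ℝ)) ∧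
        Disjoint (V false) (V true) := fun n => hnext n (T n)
  choose V hV hVd using hT
  let A : (ℕ → Bool) → ∀ n, {U : Set X // U ∈ (T n).1} := fun α n =>
    Nat.rec ⟨univ, mem_singleton _⟩ (fun n U => ⟨V n U.1 U.2 (α n), (hV n U.1 U.2 (α n)).1⟩) n
  have hAsucc : ∀ α n, (A α (n + 1)).1 = V n (A α n).1 (A α n).2 (α n) := fun _ _ => rfl
  have hanti : ∀ α, Antitone fun n => (A α n).1 := fun α =>
    antitone_nat_of_succ_le fun n => (hV n _ (A α n).2 (α n)).2.1
  have hdiam : ∀ α n, ∀ x ∈ (A α (n + 1)).1, ∀ y ∈ (A α (n + 1)).1,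
      dist x y ≤ 1 / (n + 1 : ℝ) := fun α n => (hV n _ (A α n).2 (α n)).2.2
  -- One fibre meets all pieces of a given level, so the approximants have a common image at each
  -- stage. Continuity passes this equality to the limits.
  have hpt : ∀ n, ∃ y, ∀ α, ∃ x ∈ (A α (n + 1)).1, f x = y := by
    intro n
    obtain ⟨y, hy⟩ := (T (n + 1)).2.2.2 ∅ (isThin_empty f)
    exact ⟨y, fun α => (hy _ (A α (n + 1)).2).imp fun x hx => ⟨hx.1, hx.2.2⟩⟩
  choose y hy using hpt
  choose a haA hay using hy
  have hlim : ∀ α, ∃ x, Tendsto (fun n => a n α) atTop (𝓝 x) := by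
    intro α
    refine cauchySeq_tendsto_of_complete (cauchySeq_of_le_tendsto_0
      (fun n : ℕ => 1 / ((n : ℝ) + 1)) ?_ tendsto_one_div_add_atTop_nhds_zero_nat)
    intro n m N hn hm
    exact hdiam α N _ (hanti α (Nat.succ_le_succ hn) (haA n α)) _
      (hanti α (Nat.succ_le_succ hm) (haA m α))
  choose x hx using hlim
  have hxA : ∀ α n, x α ∈ (A α n).1 := by
    intro α n
    refine ((T n).2.2.1 _ (A α n).2).mem_of_tendsto (hx α) ?_
    filter_upwards [eventually_ge_atTop n] with m hm
    exact hanti α (hm.trans (Nat.le_succ m)) (haA m α)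
  refine ⟨x, fun α β hαβ => ?_, fun α β => ?_⟩
  · by_contra hne
    have hex : ∃ n, α n ≠ β n := Function.ne_iff.1 hne
    classical
    set n := Nat.find hex
    have hn : α n ≠ β n := Nat.find_spec hex
    have heq : ∀ m ≤ n, A α m = A β m := by
      intro m
      induction m with
      | zero => intro _; rfl
      | succ m ih =>
        intro hm
        have h1 := ih (by omega)
        have h2 : α m = β m := not_not.1 (Nat.find_min hex (show m < n by omega))
        apply Subtype.ext
        rw [hAsucc, hAsucc, h2]
        congr 1
        simp only [h1]
    have h1 := hxA α (n + 1)
    have h2 := hxA β (n + 1)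
    rw [hAsucc] at h1 h2
    rw [← hαβ] at h2
    have h3 := heq n le_rfl
    have h4 : V n (A β n).1 (A β n).2 = V n (A α n).1 (A α n).2 :=
      (congrArg (fun P : {U : Set X // U ∈ (T n).1} => V n P.1 P.2) h3).symm
    rw [h4] at h2
    have hd := disjoint_left.1 (hVd n _ (A α n).2)
    cases hα : α n <;> cases hβ : β n <;> rw [hα] at h1 hn <;> rw [hβ] at h2 hn
    · exact hn rfl
    · exact hd h1 h2
    · exact hd h2 h1
    · exact hn rfl
  · have h1 := (hf.tendsto _).comp (hx α)
    have h2 := (hf.tendsto _).comp (hx β)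
    exact tendsto_nhds_unique h1 (h2.congr fun n => (hay n β).trans (hay n α).symm)

end LusinNovikov

/-- **Lusin–Novikov**: a countable-to-one Borel map is injective on each piece of a countable Borel
cover. -/
theorem exists_cover_injOn {X Y : Type*} [MeasurableSpace X] [StandardBorelSpace X]
    [MeasurableSpace Y] [StandardBorelSpace Y] {f : X → Y} (hf : Measurable f)
    (hc : ∀ y, (f ⁻¹' {y}).Countable) :
    ∃ C : ℕ → Set X, (∀ n, MeasurableSet (C n) ∧ InjOn f (C n)) ∧ ⋃ n, C n = univ := by
  let := upgradeStandardBorel X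
  let tX : TopologicalSpace X := inferInstance
  have hX : PolishSpace X := inferInstance
  let := upgradeStandardBorel Y
  -- Passing to a finer Polish topology makes `f` continuous and keeps the Borel sets.
  obtain ⟨t', ht', hfc, hpol⟩ := hf.exists_continuous
  have hb : @borel X t' = ‹MeasurableSpace X› := by
    rw [borel_eq_borel_of_le hpol hX ht']
    exact (eq_borel_upgradeStandardBorel X).symm
  let := t'
  have : PolishSpace X := hpol
  have : BorelSpace X := ⟨hb.symm⟩
  let := TopologicalSpace.upgradeIsCompletelyMetrizable X
  by_cases h : IsThick f ({univ} : Set (Set X))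
  · exfalso
    obtain ⟨x, hx, hfx⟩ := h.exists_injective hfc
    have h1 : range x ⊆ f ⁻¹' {f (x fun _ => false)} := by
      rintro _ ⟨α, rfl⟩
      exact hfx _ _
    have h2 : Countable (range x) := ((hc _).mono h1).to_subtype
    have h3 : Countable (ℕ → Bool) := (Equiv.ofInjective x hx).countable_iff.2 h2
    obtain ⟨e, he⟩ := exists_surjective_nat (ℕ → Bool)
    obtain ⟨n, hn⟩ := he fun n => !(e n n)
    have := congrFun hn n
    simp at this
  · simp only [IsThick, not_forall] at h
    obtain ⟨B, ⟨-, C, hC, hBC⟩, hy⟩ := h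
    refine ⟨C, hC, univ_subset_iff.1 ((univ_subset_iff.2 ?_).trans hBC)⟩
    by_contra hne
    obtain ⟨x, hx⟩ := (ne_univ_iff_exists_notMem B).1 hne
    exact hy ⟨f x, fun U hU => ⟨x, by rw [mem_singleton_iff.1 hU]; trivial, hx, rfl⟩⟩

/-! ### Borel quantification over countable sections -/

section CountableSections

variable {W X : Type*} [MeasurableSpace W] [StandardBorelSpace W] [MeasurableSpace X]
  [StandardBorelSpace X]

/-- The projection of a Borel set with countable sections is Borel. -/
theorem measurableSet_exists {R : W → X → Prop} (hR : MeasurableSet {p : W × X | R p.1 p.2})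
    (hc : ∀ w, {x | R w x}.Countable) : MeasurableSet {w | ∃ x, R w x} := by
  have := hR.standardBorel
  let f : {p : W × X | R p.1 p.2} → W := fun p => p.1.1
  have hf : Measurable f := measurable_fst.comp measurable_subtype_coe
  obtain ⟨C, hC, hCu⟩ := exists_cover_injOn hf (by
    intro w
    refine MapsTo.countable_of_injOn (f := fun p => p.1.2) (t := {x | R w x}) ?_ ?_ (hc w)
    · rintro ⟨⟨w', x⟩, h⟩ rfl
      exact h
    · rintro ⟨⟨w₁, x⟩, h⟩ h₁ ⟨⟨w₂, x₂⟩, h'⟩ h₂ rfl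
      cases h₁
      cases h₂
      rfl)
  have : {w | ∃ x, R w x} = ⋃ n, f '' C n := by
    rw [← image_iUnion, hCu, image_univ]
    ext w
    constructor
    · rintro ⟨x, h⟩
      exact ⟨⟨(w, x), h⟩, rfl⟩
    · rintro ⟨⟨⟨w', x⟩, h⟩, rfl⟩
      exact ⟨x, h⟩
  rw [this]
  exact MeasurableSet.iUnion fun n => (hC n).1.image_of_measurable_injOn hf (hC n).2

/-- The preimage of `B` is the projection of the part of the graph over `B`, whose sections have at
most one point. -/
theorem measurable_of_measurableSet_graph {f : W → X}
    (hf : MeasurableSet {p : W × X | f p.1 = p.2}) : Measurable f := by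
  intro B hB
  have : f ⁻¹' B = {w | ∃ x, f w = x ∧ x ∈ B} := by
    ext w
    simp
  rw [this]
  refine measurableSet_exists (hf.inter (measurable_snd hB)) fun w => ?_
  exact (countable_singleton (f w)).mono fun x hx => hx.1.symm

end CountableSections

namespace IsCBER

variable {W X : Type*} [MeasurableSpace W] [MeasurableSpace X] {E : Setoid X}

theorem measurableSet_rel (hE : IsCBER E) {f g : W → X} (hf : Measurable f) (hg : Measurable g) :
    MeasurableSet {w | E (f w) (g w)} :=
  (hf.prodMk hg) hE.measurableSet_graph

theorem countable_class' (hE : IsCBER E) (x : X) : {y | E y x}.Countable := by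
  convert hE.countable_class x using 3
  exact ⟨E.symm', E.symm'⟩

variable [StandardBorelSpace W] [StandardBorelSpace X]

theorem measurableSet_exists_rel (hE : IsCBER E) {f : W → X} (hf : Measurable f)
    {R : W → X → Prop} (hR : MeasurableSet {p : W × X | R p.1 p.2}) :
    MeasurableSet {w | ∃ x, E (f w) x ∧ R w x} :=
  measurableSet_exists
    ((hE.measurableSet_rel (hf.comp measurable_fst) measurable_snd).inter hR)
    fun w => (hE.countable_class (f w)).mono fun _ hx => hx.1

theorem measurableSet_forall_rel (hE : IsCBER E) {f : W → X} (hf : Measurable f)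
    {R : W → X → Prop} (hR : MeasurableSet {p : W × X | R p.1 p.2}) :
    MeasurableSet {w | ∀ x, E (f w) x → R w x} := by
  convert (hE.measurableSet_exists_rel (R := fun w x => ¬ R w x) hf hR.compl).compl using 1
  ext w
  simp

/-- A countable Borel equivalence relation is a countable union of graphs of Borel partial
injections. -/
theorem exists_partial_injections (hE : IsCBER E) : ∃ P : ℕ → X → X → Prop,
    (∀ n, MeasurableSet {p : X × X | P n p.1 p.2}) ∧ (∀ x y, E x y ↔ ∃ n, P n x y) ∧
    (∀ n x y y', P n x y → P n x y' → y = y') ∧ ∀ n x x' y, P n x y → P n x' y → x = x' := by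
  have := hE.measurableSet_graph.standardBorel
  set G := {p : X × X | E p.1 p.2}
  have hf : Measurable fun p : G => p.1.1 := measurable_fst.comp measurable_subtype_coe
  have hg : Measurable fun p : G => p.1.2 := measurable_snd.comp measurable_subtype_coe
  obtain ⟨C, hC, hCu⟩ := exists_cover_injOn hf (by
    intro x
    refine MapsTo.countable_of_injOn (f := fun p => p.1.2) (t := {y | E x y}) ?_ ?_
      (hE.countable_class x)
    · rintro ⟨⟨x', y⟩, h⟩ rfl
      exact h
    · rintro ⟨⟨x₁, y⟩, h⟩ h₁ ⟨⟨x₂, y₂⟩, h'⟩ h₂ rfl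
      cases h₁
      cases h₂
      rfl)
  obtain ⟨D, hD, hDu⟩ := exists_cover_injOn hg (by
    intro y
    refine MapsTo.countable_of_injOn (f := fun p => p.1.1) (t := {x | E x y}) ?_ ?_
      (hE.countable_class' y)
    · rintro ⟨⟨x', y⟩, h⟩ rfl
      exact h
    · rintro ⟨⟨x₁, y⟩, h⟩ h₁ ⟨⟨x₂, y₂⟩, h'⟩ h₂ rfl
      cases h₁
      cases h₂
      rfl)
  -- Intersecting a cover injective in the first coordinate with one injective in the second makes
  -- each piece a partial injection.
  refine ⟨fun n x y => (x, y) ∈ Subtype.val '' (C n.unpair.1 ∩ D n.unpair.2), fun n => ?_,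
    fun x y => ⟨fun h => ?_, ?_⟩, ?_, ?_⟩
  · exact hE.measurableSet_graph.subtype_image ((hC _).1.inter (hD _).1)
  · obtain ⟨m, hm⟩ := mem_iUnion.1 (hCu ▸ mem_univ (⟨(x, y), h⟩ : G))
    obtain ⟨n, hn⟩ := mem_iUnion.1 (hDu ▸ mem_univ (⟨(x, y), h⟩ : G))
    exact ⟨Nat.pair m n, ⟨(x, y), h⟩, by simpa using ⟨hm, hn⟩, rfl⟩
  · rintro ⟨n, ⟨p, hp⟩, -, rfl⟩
    exact hp
  · rintro n x y y' ⟨p, hp, hpx⟩ ⟨q, hq, hqx⟩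
    have := (hC _).2 hp.1 hq.1 (by simp [hpx, hqx])
    subst this
    exact congrArg Prod.snd (hpx.symm.trans hqx)
  · rintro n x x' y ⟨p, hp, hpx⟩ ⟨q, hq, hqx⟩
    have := (hD _).2 hp.2 hq.2 (by simp [hpx, hqx])
    subst this
    exact congrArg Prod.fst (hpx.symm.trans hqx)

end IsCBER

/-! ### Layers of finite classes -/

/-- A finite Borel equivalence relation is layered by Borel partial transversals, the number of
layers on each class being at most the size of the class. -/
theorem IsCBER.exists_layers {X : Type*} [MeasurableSpace X] [StandardBorelSpace X] {L : Setoid X}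
    (hL : IsCBER L) (hfin : ∀ x, {y | L x y}.Finite) : ∃ I : ℕ → Set X,
      (∀ j, MeasurableSet (I j)) ∧ (∀ j, ∀ x ∈ I j, ∀ y ∈ I j, L x y → x = y) ∧
      (∀ x, ∃ j < {y | L x y}.ncard, x ∈ I j) ∧ ∀ x, ∃ y ∈ I 0, L x y := by
  obtain ⟨e, he⟩ := exists_measurableEmbedding_real X
  -- `P j x` says that a chain of `j` strict descents in `e` starts at `x` inside its class; the
  -- layer `I j` consists of the points of rank exactly `j`.
  let P : ℕ → X → Prop := fun j =>
    Nat.rec (fun _ => True) (fun _ p x => ∃ x', L x x' ∧ e x' < e x ∧ p x') j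
  have hP : ∀ j x, P (j + 1) x ↔ ∃ x', L x x' ∧ e x' < e x ∧ P j x' := fun _ _ => Iff.rfl
  have hPm : ∀ j, MeasurableSet {x | P j x} := by
    intro j
    induction j with
    | zero => exact MeasurableSet.univ
    | succ j ih =>
      refine hL.measurableSet_exists_rel measurable_id ?_
      exact (measurableSet_lt (he.measurable.comp measurable_snd)
        (he.measurable.comp measurable_fst)).inter (measurable_snd ih)
  have hbound : ∀ j x, P j x → j < {y | L x y ∧ e y ≤ e x}.ncard := by
    intro j
    induction j with
    | zero =>
      intro x _
      exact (ncard_pos ((hfin x).subset fun y hy => hy.1)).2 ⟨x, L.refl' x, le_rfl⟩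
    | succ j ih =>
      intro x hx
      obtain ⟨x', h1, h2, h3⟩ := (hP j x).1 hx
      refine (Nat.succ_le_of_lt (ih x' h3)).trans_lt
        (ncard_lt_ncard ⟨?_, ?_⟩ ((hfin x).subset fun y hy => hy.1))
      · exact fun y hy => ⟨L.trans' h1 hy.1, hy.2.trans h2.le⟩
      · exact fun h => absurd (h (show L x x ∧ e x ≤ e x from ⟨L.refl' x, le_rfl⟩)).2 (not_le.2 h2)
  refine ⟨fun j => {x | P j x ∧ ¬ P (j + 1) x}, fun j => (hPm j).inter (hPm (j + 1)).compl,
    ?_, ?_, ?_⟩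
  · rintro j x ⟨hx, hx'⟩ y ⟨hy, hy'⟩ hxy
    rcases lt_trichotomy (e x) (e y) with h | h | h
    · exact absurd ((hP j y).2 ⟨x, L.symm' hxy, h, hx⟩) hy'
    · exact he.injective h
    · exact absurd ((hP j x).2 ⟨y, hxy, h, hy⟩) hx'
  · intro x
    classical
    have hex : ∃ j, ¬ P (j + 1) x := ⟨{y | L x y ∧ e y ≤ e x}.ncard, fun h => by
      have := hbound (Set.ncard _ + 1) x h
      omega⟩
    have hj : P (Nat.find hex) x := by
      rcases h : Nat.find hex with _ | j
      · trivial
      · exact not_not.1 (Nat.find_min hex (show j < Nat.find hex by omega))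
    exact ⟨Nat.find hex, (hbound _ x hj).trans_le
      (ncard_le_ncard (fun y hy => hy.1) (hfin x)), hj, Nat.find_spec hex⟩
  · intro x
    obtain ⟨y, hy, hmin⟩ := exists_min_image {y | L x y} e (hfin x) ⟨x, L.refl' x⟩
    refine ⟨y, ⟨trivial, ?_⟩, hy⟩
    rintro ⟨z, hz, hlt, -⟩
    exact absurd (hmin z (L.trans' hy hz)) (not_le.2 hlt)

/-- The sets `{z | K w z}` are pairwise disjoint, and each one consists of exactly one `L`-class
from each `F`-class of some `F'`-class. -/
structure IsTransversalFamily {W X : Type*} (F F' L : Setoid X) (K : W → X → Prop) : Prop where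
  eq_of_mem : ∀ {w w' z}, K w z → K w' z → w = w'
  of_rel : ∀ {w z z'}, K w z → L z z' → K w z'
  rel : ∀ {w z z'}, K w z → K w z' → F' z z'
  rel_of_rel : ∀ {w z z'}, K w z → K w z' → F z z' → L z z'
  exists_rel : ∀ {w z x}, K w z → F' z x → ∃ z', F x z' ∧ K w z'

/-! ### Links and families of blocks -/

section Link

variable {X : Type*} [MeasurableSpace X] {E F F' L : Setoid X}

theorem IsLink.eq_of_rel (hL : IsLink E F L) {x y : X} (hE : E x y) (h : L x y) : x = y := by
  obtain ⟨z, -, hz⟩ := hL.existsUnique_mem x x (F.refl' x)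
  rw [hz x ⟨E.refl' x, L.refl' x⟩, hz y ⟨hE, h⟩]

theorem finite_class_of_link (hL : IsLink E F L) (hFF' : F ≤ F') (hfin : HasFiniteIndexIn E F')
    (x : X) : {y | L x y}.Finite := by
  refine Set.Finite.of_finite_image (f := Quotient.mk E)
    ((hfin x).subset (image_mono fun y hy => hFF' (hL.le hy))) ?_
  intro y hy z hz h
  exact hL.eq_of_rel (Quotient.exact h) (L.trans' (L.symm' hy) hz)

/-- An `L`-class meets each `E`-class at most once. The bound is uniform over the `F'`-class, so
boundedly many layers suffice there. -/
theorem ncard_class_le (hL : IsLink E F L) (hFF' : F ≤ F') (hfin : HasFiniteIndexIn E F')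
    {x x' : X} (h : F' x x') : {y | L x' y}.ncard ≤ (Quotient.mk E '' {y | F' x y}).ncard := by
  refine ncard_le_ncard_of_injOn (Quotient.mk E) ?_ ?_ (hfin x)
  · exact fun y hy => ⟨y, F'.trans' h (hFF' (hL.le hy)), rfl⟩
  · intro y hy z hz h
    exact hL.eq_of_rel (Quotient.exact h) (L.trans' (L.symm' hy) hz)

/-- `M` is an `(E, F')`-link above the set `A`. -/
structure IsLinkOn (E F' M : Setoid X) (A : Set X) : Prop where
  measurableSet_graph : MeasurableSet {p : X × X | M p.1 p.2}
  le : M ≤ F'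
  existsUnique_mem : ∀ y ∈ A, ∀ x, F' x y → ∃! z : X, E x z ∧ M y z

/-- Blocks become classes and uncovered points keep their `L`-class. A block contains an `L`-class
inside the `F`-class of `x`, and that `L`-class meets the `E`-class of `x` because `L` is a link. -/
theorem IsTransversalFamily.exists_link {W : Type*} [MeasurableSpace W] [StandardBorelSpace W]
    [StandardBorelSpace X] {K : W → X → Prop}
    (hK : IsTransversalFamily F F' L K) (hL : IsLink E F L) (hEF : E ≤ F) (hFF' : F ≤ F')
    (hKm : MeasurableSet {p : W × X | K p.1 p.2}) :
    ∃ M : Setoid X, L ≤ M ∧ IsLinkOn E F' M {z | ∃ w, K w z} ∧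
      ∀ x y, M x y → ∀ w, K w x → K w y := by
  let M : Setoid X :=
    { r := fun z z' => L z z' ∨ ∃ w, K w z ∧ K w z'
      iseqv :=
        { refl := fun z => Or.inl (L.refl' z)
          symm := by
            rintro z z' (h | ⟨w, h, h'⟩)
            exacts [Or.inl (L.symm' h), Or.inr ⟨w, h', h⟩]
          trans := by
            rintro x y z (h | ⟨w, h1, h2⟩) (h' | ⟨w', h3, h4⟩)
            · exact Or.inl (L.trans' h h')
            · exact Or.inr ⟨w', hK.of_rel h3 (L.symm' h), h4⟩
            · exact Or.inr ⟨w, h1, hK.of_rel h2 h'⟩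
            · rw [hK.eq_of_mem h2 h3] at h1
              exact Or.inr ⟨w', h1, h4⟩ } }
  have hMK : ∀ x y, M x y → ∀ w, K w x → K w y := by
    rintro x y (h | ⟨w', h, h'⟩) w hw
    · exact hK.of_rel hw h
    · rwa [hK.eq_of_mem hw h]
  refine ⟨M, fun _ _ h => Or.inl h, ⟨?_, ?_, ?_⟩, hMK⟩
  · refine hL.isCBER.measurableSet_graph.union ?_
    refine measurableSet_exists (R := fun (p : X × X) w => K w p.1 ∧ K w p.2) ?_ fun p => ?_
    · exact ((measurable_snd.prodMk (measurable_fst.comp measurable_fst)) hKm).inter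
        ((measurable_snd.prodMk (measurable_snd.comp measurable_fst)) hKm)
    · exact Set.Subsingleton.countable fun w hw w' hw' => hK.eq_of_mem hw.1 hw'.1
  · rintro x y (h | ⟨w, h, h'⟩)
    exacts [hFF' (hL.le h), hK.rel h h']
  · rintro y ⟨w, hw⟩ x hxy
    obtain ⟨z', hz', hwz'⟩ := hK.exists_rel hw (F'.symm' hxy)
    obtain ⟨z, ⟨hxz, hz'z⟩, -⟩ := hL.existsUnique_mem x z' hz'
    have hwz := hK.of_rel hwz' hz'z
    refine ⟨z, ⟨hxz, Or.inr ⟨w, hw, hwz⟩⟩, ?_⟩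
    rintro u ⟨hxu, hyu⟩
    have hEuz : E u z := E.trans' (E.symm' hxu) hxz
    exact hL.eq_of_rel hEuz (hK.rel_of_rel (hMK y u hyu w hw) hwz (hEF hEuz))

theorem IsLinkOn.glue [StandardBorelSpace X] {M M' : Setoid X} {Z : Set X}
    (hM : IsLinkOn E F' M Zᶜ) (hM' : IsLinkOn E F' M' Z) (hF' : IsCBER F') (hLM : L ≤ M)
    (hLM' : L ≤ M') (hZ : MeasurableSet Z) (hinv : ∀ x y, F' x y → x ∈ Z → y ∈ Z) :
    ∃ L' : Setoid X, IsLink E F' L' ∧ L ≤ L' := by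
  let N : Setoid X :=
    { r := fun x y => (x ∈ Z ∧ M' x y) ∨ (x ∉ Z ∧ M x y)
      iseqv :=
        { refl := fun z => (em (z ∈ Z)).imp (fun h => ⟨h, M'.refl' z⟩) fun h => ⟨h, M.refl' z⟩
          symm := by
            rintro x y (⟨h, h'⟩ | ⟨h, h'⟩)
            · exact Or.inl ⟨hinv x y (hM'.le h') h, M'.symm' h'⟩
            · exact Or.inr ⟨fun hy => h (hinv y x (F'.symm' (hM.le h')) hy), M.symm' h'⟩
          trans := by
            rintro x y z (⟨h, h'⟩ | ⟨h, h'⟩) (⟨k, k'⟩ | ⟨k, k'⟩)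
            · exact Or.inl ⟨h, M'.trans' h' k'⟩
            · exact absurd (hinv x y (hM'.le h') h) k
            · exact absurd (hinv y x (F'.symm' (hM.le h')) k) h
            · exact Or.inr ⟨h, M.trans' h' k'⟩ } }
  have hNF : N ≤ F' := by
    rintro x y (⟨-, h⟩ | ⟨-, h⟩)
    exacts [hM'.le h, hM.le h]
  have hNm : MeasurableSet {p : X × X | N p.1 p.2} :=
    ((measurable_fst hZ).inter hM'.measurableSet_graph).union
      ((measurable_fst hZ.compl).inter hM.measurableSet_graph)
  refine ⟨N, ⟨⟨hNm, fun x => (hF'.countable_class x).mono fun y hy => hNF hy⟩, hNF, ?_⟩, ?_⟩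
  · intro x y hxy
    by_cases hy : y ∈ Z
    · obtain ⟨z, hz, hzu⟩ := hM'.existsUnique_mem y hy x hxy
      refine ⟨z, ⟨hz.1, Or.inl ⟨hy, hz.2⟩⟩, ?_⟩
      rintro u ⟨hu, ⟨-, h⟩ | ⟨h, -⟩⟩
      exacts [hzu u ⟨hu, h⟩, absurd hy h]
    · obtain ⟨z, hz, hzu⟩ := hM.existsUnique_mem y hy x hxy
      refine ⟨z, ⟨hz.1, Or.inr ⟨hy, hz.2⟩⟩, ?_⟩
      rintro u ⟨hu, ⟨h, -⟩ | ⟨-, h⟩⟩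
      exacts [absurd h hy, hzu u ⟨hu, h⟩]
  · intro x y h
    exact (em (x ∈ Z)).imp (fun hx => ⟨hx, hLM' h⟩) fun hx => ⟨hx, hLM h⟩

end Link

/-! ### A maximal disjoint family of blocks -/

theorem measurableSet_exists_countable {W ι : Type*} [MeasurableSpace W] [Countable ι]
    {p : ι → W → Prop} (h : ∀ i, MeasurableSet {w | p i w}) : MeasurableSet {w | ∃ i, p i w} := by
  rw [Set.ofPred_exists]
  exact MeasurableSet.iUnion h

theorem measurableSet_forall_countable {W ι : Type*} [MeasurableSpace W] [Countable ι]
    {p : ι → W → Prop} (h : ∀ i, MeasurableSet {w | p i w}) : MeasurableSet {w | ∀ i, p i w} := by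
  rw [Set.ofPred_forall]
  exact MeasurableSet.iInter h

theorem measurableSet_forall_lt {W : Type*} [MeasurableSpace W] {p : ℕ → W → Prop}
    (h : ∀ i, MeasurableSet {w | p i w}) (j : ℕ) : MeasurableSet {w | ∀ i, i < j → p i w} := by
  refine measurableSet_forall_countable fun i => ?_
  by_cases hi : i < j
  · simpa [hi] using h i
  · simp [hi]

/-- Countably many Borel sets separate points from finite sets. -/
theorem exists_separating_sets (X : Type*) [MeasurableSpace X] [StandardBorelSpace X] :
    ∃ B : ℕ → Set X, (∀ n, MeasurableSet (B n)) ∧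
      ∀ (x : X) (S : Set X), S.Finite → x ∉ S → ∃ n, x ∈ B n ∧ Disjoint (B n) S := by
  let := upgradeStandardBorel X
  rcases isEmpty_or_nonempty X with h | ⟨⟨x₀⟩⟩
  · exact ⟨fun _ => ∅, fun _ => MeasurableSet.empty, fun x => h.elim x⟩
  have hb := TopologicalSpace.isBasis_countableBasis X
  obtain ⟨V, hV, -, -⟩ := hb.exists_subset_of_mem_open (mem_univ x₀) isOpen_univ
  obtain ⟨B, hB⟩ := (TopologicalSpace.countable_countableBasis X).exists_eq_range ⟨V, hV⟩
  refine ⟨B, fun n => (hb.isOpen (hB ▸ mem_range_self n)).measurableSet, fun x S hS hx => ?_⟩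
  obtain ⟨U, hU, hxU, hUS⟩ := hb.exists_subset_of_mem_open (mem_compl hx) hS.isClosed.isOpen_compl
  rw [hB] at hU
  obtain ⟨n, rfl⟩ := hU
  exact ⟨n, hxU, disjoint_left.2 fun y hy => hUS hy⟩

/-- There is a disjoint Borel family of `L`-invariant `F`-transversals of `F'`-classes that is
maximal, in the sense that it covers at least one `F`-class in each `F'`-class. -/
theorem exists_maximal_transversalFamily {X : Type*} [MeasurableSpace X] [StandardBorelSpace X]
    {F F' L : Setoid X} (hF : IsCBER F) (hF' : IsCBER F') (hL : IsCBER L) (hFF' : F ≤ F')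
    (hLF : L ≤ F) (hLfin : ∀ x, {y | L x y}.Finite) (hfin : HasFiniteIndexIn F F') :
    ∃ K : ℕ × X → X → Prop, MeasurableSet {p : (ℕ × X) × X | K p.1 p.2} ∧
      IsTransversalFamily F F' L K ∧ ∀ x, ∃ y, F' x y ∧ ∀ z, F y z → ∃ w, K w z := by
  obtain ⟨P, hPm, hPF, hPr, hPl⟩ := hF'.exists_partial_injections
  obtain ⟨B, hBm, hB⟩ := exists_separating_sets X
  obtain ⟨s, hs⟩ := exists_surjective_nat (Finset ℕ)
  -- `S t x` is the candidate block coded by `t` at `x`: the `L`-saturation of the images of `x`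
  -- under the partial injections indexed by `t`. `D t x` below says that it really is a block.
  let S : Finset ℕ → X → X → Prop := fun t x z => ∃ i, i ∈ t ∧ ∃ y, L z y ∧ P i x y
  have hSF : ∀ {t x z}, S t x z → F' x z := by
    rintro t x z ⟨i, -, y, h, h'⟩
    exact F'.trans' ((hPF x y).2 ⟨i, h'⟩) (F'.symm' (hFF' (hLF h)))
  have hSL : ∀ {t x z z'}, S t x z → L z z' → S t x z' := by
    rintro t x z z' ⟨i, hi, y, h, h'⟩ hz
    exact ⟨i, hi, y, L.trans' (L.symm' hz) h, h'⟩
  have hSm : ∀ t, MeasurableSet {p : X × X | S t p.1 p.2} := by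
    refine fun t => measurableSet_exists_countable fun i => (MeasurableSet.const _).inter ?_
    refine hL.measurableSet_exists_rel measurable_snd ?_
    exact (by fun_prop : Measurable fun p : (X × X) × X => (p.1.1, p.2)) (hPm i)
  let D : Finset ℕ → X → Prop := fun t x =>
    (∀ z, F' x z → ∀ z', F' x z' → ¬ (S t x z ∧ S t x z' ∧ F z z' ∧ ¬ L z z')) ∧
      ∀ x', F' x x' → ∃ z', F x' z' ∧ S t x z'
  have hDm : ∀ t, MeasurableSet {x | D t x} := by
    intro t
    refine MeasurableSet.inter ?_ ?_
    · refine hF'.measurableSet_forall_rel measurable_id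
        (R := fun x z => ∀ z', F' x z' → ¬ (S t x z ∧ S t x z' ∧ F z z' ∧ ¬ L z z')) ?_
      refine hF'.measurableSet_forall_rel measurable_fst
        (R := fun p z' => ¬ (S t p.1 p.2 ∧ S t p.1 z' ∧ F p.2 z' ∧ ¬ L p.2 z')) ?_
      refine (MeasurableSet.inter ?_ (MeasurableSet.inter ?_ (MeasurableSet.inter ?_
        (MeasurableSet.compl ?_)))).compl
      · exact measurable_fst (hSm t)
      · exact (by fun_prop : Measurable fun p : (X × X) × X => (p.1.1, p.2)) (hSm t)
      · exact hF.measurableSet_rel (by fun_prop) (by fun_prop)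
      · exact hL.measurableSet_rel (by fun_prop) (by fun_prop)
    · refine hF'.measurableSet_forall_rel measurable_id
        (R := fun x x' => ∃ z', F x' z' ∧ S t x z') ?_
      refine hF.measurableSet_exists_rel measurable_snd (R := fun p z' => S t p.1 z') ?_
      exact (by fun_prop : Measurable fun p : (X × X) × X => (p.1.1, p.2)) (hSm t)
  let Cf : Finset ℕ → X → X → Prop := fun t x x' => ∃ z, F' x z ∧ S t x z ∧ S t x' z
  have hCm : ∀ t, MeasurableSet {p : X × X | Cf t p.1 p.2} := by
    intro t
    refine hF'.measurableSet_exists_rel measurable_fst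
      (R := fun p z => S t p.1 z ∧ S t p.2 z) (MeasurableSet.inter ?_ ?_)
    · exact (by fun_prop : Measurable fun p : (X × X) × X => (p.1.1, p.2)) (hSm t)
    · exact (by fun_prop : Measurable fun p : (X × X) × X => (p.1.2, p.2)) (hSm t)
  -- For fixed `t` the conflict graph is locally finite, as the `P i` are injective and `L`-classes
  -- finite. Hence it has a countable Borel colouring: `Pc t n` holds for points alone in `B n`
  -- among their conflicting neighbours.
  have hCfin : ∀ t x, {x' | Cf t x x'}.Finite := by
    intro t x
    have h1 : ∀ i, {y | P i x y}.Finite := fun i =>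
      Set.Subsingleton.finite fun y hy y' hy' => hPr i x y y' hy hy'
    have h2 : ∀ i y, {x' | P i x' y}.Finite := fun i y =>
      Set.Subsingleton.finite fun x hx x' hx' => hPl i x x' y hx hx'
    have h3 := t.finite_toSet.biUnion fun i _ => (h1 i).biUnion fun y _ => (hLfin y).biUnion
      fun y' _ => t.finite_toSet.biUnion fun j _ => h2 j y'
    refine h3.subset ?_
    rintro x' ⟨z, -, ⟨i, hi, y, hzy, hxy⟩, ⟨j, hj, y', hzy', hxy'⟩⟩
    simp only [mem_iUnion]
    exact ⟨i, hi, y, hxy, y', L.trans' (L.symm' hzy) hzy', j, hj, hxy'⟩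
  let Pc : Finset ℕ → ℕ → X → Prop := fun t n x =>
    x ∈ B n ∧ D t x ∧ ¬ ∃ x', F' x x' ∧ x' ∈ B n ∧ x' ≠ x ∧ Cf t x x'
  have hPcm : ∀ t n, MeasurableSet {x | Pc t n x} := by
    intro t n
    refine (hBm n).inter ((hDm t).inter (MeasurableSet.compl ?_))
    refine hF'.measurableSet_exists_rel measurable_id
      (R := fun x x' => x' ∈ B n ∧ x' ≠ x ∧ Cf t x x') ?_
    exact (measurable_snd (hBm n)).inter
      ((measurableSet_eq_fun measurable_snd measurable_fst).compl.inter (hCm t))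
  have hPcover : ∀ t x, D t x → ∃ n, Pc t n x := by
    intro t x hx
    obtain ⟨n, hn, hd⟩ := hB x ({x' | Cf t x x'} \ {x}) (hCfin t x).sdiff (by simp)
    refine ⟨n, hn, hx, ?_⟩
    rintro ⟨x', -, h1, h2, h3⟩
    exact disjoint_left.1 hd h1 ⟨h3, h2⟩
  -- Stage `n` codes a pair of index set and colour; it accepts all candidates of that kind disjoint
  -- from the part `A` already covered. Every pair is treated once.
  let Sel : ℕ → Set X → X → Prop := fun n A x =>
    Pc (s n.unpair.1) n.unpair.2 x ∧ ∀ z, F' x z → ¬ (S (s n.unpair.1) x z ∧ z ∈ A)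
  have hSelm : ∀ n A, MeasurableSet A → MeasurableSet {x | Sel n A x} := by
    intro n A hA
    refine (hPcm _ _).inter (hF'.measurableSet_forall_rel measurable_id
      (R := fun x z => ¬ (S (s n.unpair.1) x z ∧ z ∈ A)) ?_)
    exact ((hSm _).inter (measurable_snd hA)).compl
  let A : ℕ → Set X := fun n => Nat.rec ∅
    (fun n A => A ∪ {z | ∃ x, F' z x ∧ Sel n A x ∧ S (s n.unpair.1) x z}) n
  have hAsucc : ∀ n, A (n + 1) = A n ∪ {z | ∃ x, F' z x ∧ Sel n (A n) x ∧
      S (s n.unpair.1) x z} := fun _ => rfl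
  have hAm : ∀ n, MeasurableSet (A n) := by
    intro n
    induction n with
    | zero => exact MeasurableSet.empty
    | succ n ih =>
      rw [hAsucc]
      refine ih.union (hF'.measurableSet_exists_rel measurable_id
        (R := fun z x => Sel n (A n) x ∧ S (s n.unpair.1) x z) ?_)
      exact (measurable_snd (hSelm n _ ih)).inter (measurable_swap (hSm _))
  have hAmono : Monotone A := monotone_nat_of_le_succ fun n => by
    rw [hAsucc]
    exact subset_union_left
  let K : ℕ × X → X → Prop := fun w z => Sel w.1 (A w.1) w.2 ∧ S (s w.1.unpair.1) w.2 z
  have hKA : ∀ {n x z}, K (n, x) z → z ∈ A (n + 1) := by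
    rintro n x z ⟨h, h'⟩
    exact Or.inr ⟨x, F'.symm' (hSF h'), h, h'⟩
  have hlt : ∀ {n n' x x' z}, K (n, x) z → K (n', x') z → ¬ n < n' := by
    rintro n n' x x' z h h' hlt
    exact h'.1.2 z (hSF h'.2) ⟨h'.2, hAmono hlt (hKA h)⟩
  refine ⟨K, ?_, ⟨?_, ?_, ?_, ?_, ?_⟩, ?_⟩
  · have : {p : (ℕ × X) × X | K p.1 p.2} =
        ⋃ n, {p : (ℕ × X) × X | p.1.1 = n} ∩ {p | Sel n (A n) p.1.2 ∧
          S (s n.unpair.1) p.1.2 p.2} := by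
      ext p
      simp [K]
    rw [this]
    refine MeasurableSet.iUnion fun n => MeasurableSet.inter ?_ (MeasurableSet.inter ?_ ?_)
    · exact (by fun_prop : Measurable fun p : (ℕ × X) × X => p.1.1) (measurableSet_singleton n)
    · exact (by fun_prop : Measurable fun p : (ℕ × X) × X => p.1.2) (hSelm n _ (hAm n))
    · exact (by fun_prop : Measurable fun p : (ℕ × X) × X => (p.1.2, p.2)) (hSm _)
  · rintro ⟨n, x⟩ ⟨n', x'⟩ z h h'
    obtain rfl : n = n' := le_antisymm (not_lt.1 (hlt h' h)) (not_lt.1 (hlt h h'))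
    by_contra hne
    refine h.1.1.2.2 ⟨x', F'.trans' (hSF h.2) (F'.symm' (hSF h'.2)), h'.1.1.1, ?_, z, hSF h.2,
      h.2, h'.2⟩
    rintro rfl
    exact hne rfl
  · exact fun h hL => ⟨h.1, hSL h.2 hL⟩
  · exact fun h h' => F'.trans' (F'.symm' (hSF h.2)) (hSF h'.2)
  · intro w z z' h h' hF
    by_contra hne
    exact h.1.1.2.1.1 z (hSF h.2) z' (hSF h'.2) ⟨h.2, h'.2, hF, hne⟩
  · intro w z x h hz
    obtain ⟨z', h1, h2⟩ := h.1.1.2.1.2 x (F'.trans' (hSF h.2) hz)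
    exact ⟨z', h1, h.1, h2⟩
  · have hAK : ∀ n z, z ∈ A n → ∃ w, K w z := by
      intro n
      induction n with
      | zero => exact fun z hz => absurd hz (notMem_empty z)
      | succ n ih =>
        rintro z (hz | ⟨x, -, h, h'⟩)
        exacts [ih z hz, ⟨(n, x), h, h'⟩]
    intro x
    by_contra hcon
    push Not at hcon
    have hz : ∀ q : (Quotient.mk F '' {y | F' x y}), ∃ z, Quotient.mk F z = q.1 ∧
        (∀ w, ¬ K w z) ∧ ∃ i, P i x z := by
      rintro ⟨_, y, hy, rfl⟩
      obtain ⟨z, hz, hz'⟩ := hcon y hy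
      exact ⟨z, Quotient.sound (F.symm' hz), hz', (hPF _ _).1 (F'.trans' hy (hFF' hz))⟩
    choose z hzF hzK c hc using hz
    have := (hfin x).to_subtype
    -- If each `F`-class had an uncovered point, finitely many such points would form a candidate
    -- block; the stage of its index set and colour would have accepted it.
    let t := (finite_range c).toFinset
    have hSz : ∀ q, S t x (z q) := fun q => ⟨c q, by simp [t], z q, L.refl' _, hc q⟩
    have hSt : ∀ u, S t x u → ∃ q, L u (z q) := by
      rintro u ⟨i, hi, y, huy, hxy⟩
      obtain ⟨q, rfl⟩ : ∃ q, c q = i := by simpa [t] using hi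
      exact ⟨q, hPr _ _ _ _ hxy (hc q) ▸ huy⟩
    have hDt : D t x := by
      refine ⟨?_, fun x' hx' => ?_⟩
      · rintro u - u' - ⟨hu, hu', hF, hne⟩
        obtain ⟨q, hq⟩ := hSt u hu
        obtain ⟨q', hq'⟩ := hSt u' hu'
        obtain rfl : q = q' := by
          apply Subtype.ext
          rw [← hzF q, ← hzF q']
          exact Quotient.sound (F.trans' (F.symm' (hLF hq)) (F.trans' hF (hLF hq')))
        exact hne (L.trans' hq (L.symm' hq'))
      · exact ⟨z ⟨_, x', hx', rfl⟩, F.symm' (Quotient.exact (hzF ⟨_, x', hx', rfl⟩)), hSz _⟩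
    obtain ⟨k, hk⟩ := hPcover t x hDt
    obtain ⟨m, hm⟩ := hs t
    have hsel : Sel (Nat.pair m k) (A (Nat.pair m k)) x := by
      refine ⟨by simpa [hm] using hk, ?_⟩
      rintro u - ⟨hu, huA⟩
      rw [Nat.unpair_pair, hm] at hu
      obtain ⟨q, hq⟩ := hSt u hu
      obtain ⟨w, hw⟩ := hAK _ _ huA
      exact hzK q w ⟨hw.1, hSL hw.2 hq⟩
    refine hzK ⟨_, x, F'.refl' x, rfl⟩ (Nat.pair m k, x) ⟨hsel, ?_⟩
    simpa [hm] using hSz _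

/-! ### Compressing `E` where the blocks do not cover -/

section Compression

variable {X : Type*} [MeasurableSpace X] [StandardBorelSpace X] {E F F' L : Setoid X}

/-- If a partial link `M` covers some but not all `F`-classes of an `F'`-class, then `E` is
compressible there. -/
theorem IsLinkOn.exists_compression {M : Setoid X} {A : Set X} (hM : IsLinkOn E F' M A)
    (hE : IsCBER E) (hF : IsCBER F) (hF' : IsCBER F') (hL : IsLink E F L) (hEF : E ≤ F)
    (hnorm : IsNormalIn E F') (hLM : L ≤ M)
    (hMA : ∀ x y, M x y → x ∈ A → y ∈ A) (hAm : MeasurableSet A)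
    (hA : ∀ x, ∃ y, F' x y ∧ ∀ z, F y z → z ∈ A) :
    ∃ σ : X → X, Measurable σ ∧ Function.Injective σ ∧ (∀ x, E x (σ x)) ∧
      ∀ x, (∃ y, F' x y ∧ y ∉ A) → ∃ b, E x b ∧ b ∉ range σ := by
  obtain ⟨G, hG, hGF⟩ := hnorm
  obtain ⟨g, hg⟩ := exists_surjective_nat G
  let T : ℕ → Equiv.Perm X := fun n => (g n).1.1
  have hTm : ∀ n, Measurable (T n) := fun n => (g n).1.2.1
  have hTE : ∀ n x y, E x y ↔ E (T n x) (T n y) := fun n => (g n).1.2.2.2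
  have hTF : ∀ x y, F' x y ↔ ∃ n, E (T n x) y := by
    intro x y
    rw [hGF]
    constructor
    · rintro ⟨S, hS, h⟩
      obtain ⟨n, hn⟩ := hg ⟨S, hS⟩
      exact ⟨n, by simpa [T, hn] using h⟩
    · rintro ⟨n, h⟩
      exact ⟨(g n).1, (g n).2, h⟩
  have hTF' : ∀ n x, F' x (T n x) := fun n x => (hTF _ _).2 ⟨n, E.refl' _⟩
  let Z : Set X := {x | ∃ y, F' x y ∧ y ∉ A}
  have hZm : MeasurableSet Z :=
    hF'.measurableSet_exists_rel measurable_id (R := fun _ y => y ∉ A) (measurable_snd hAm.compl)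
  let Full : X → Prop := fun x => ∀ z, F x z → z ∈ A
  have hFullm : MeasurableSet {x | Full x} :=
    hF.measurableSet_forall_rel measurable_id (R := fun _ y => y ∈ A) (measurable_snd hAm)
  have hFullE : ∀ {x y}, E x y → Full x → Full y := fun h hx z hz =>
    hx z (F.trans' (hEF h) hz)
  -- `n` codes two automorphisms, the first taking `x` into a covered `F`-class and the second into
  -- one not wholly covered. The least such code, selected by `q`, depends only on the `E`-class.
  let p : ℕ → X → Prop := fun n x => Full (T n.unpair.1 x) ∧ ¬ Full (T n.unpair.2 x)
  have hpm : ∀ n, MeasurableSet {x | p n x} := fun n =>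
    (hTm _ hFullm).inter (hTm _ hFullm).compl
  have hpE : ∀ {n x y}, E x y → p n x → p n y := fun h hx =>
    ⟨hFullE ((hTE _ _ _).1 h) hx.1, fun h' => hx.2 (hFullE ((hTE _ _ _).1 (E.symm' h)) h')⟩
  let q : ℕ → X → Prop := fun n x => p n x ∧ ∀ m, m < n → ¬ p m x
  have hqm : ∀ n, MeasurableSet {x | q n x} := by
    intro n
    exact (hpm n).inter (measurableSet_forall_lt (fun m => (hpm m).compl) n)
  have hqu : ∀ {n m x y}, E x y → q n x → q m y → n = m := by
    intro n m x y h hn hm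
    rcases lt_trichotomy n m with hlt | heq | hlt
    · exact absurd (hpE h hn.1) (hm.2 n hlt)
    · exact heq
    · exact absurd (hpE (E.symm' h) hm.1) (hn.2 m hlt)
  have hqe : ∀ x ∈ Z, ∃ n, q n x := by
    rintro x ⟨y, hxy, hy⟩
    have hex : ∃ n, p n x := by
      obtain ⟨n, hn⟩ := (hTF x y).1 hxy
      obtain ⟨u, hxu, hu⟩ := hA x
      obtain ⟨m, hm⟩ := (hTF x u).1 hxu
      exact ⟨Nat.pair m n, by simpa [p] using
        ⟨hFullE (E.symm' hm) hu, fun h => hy (h y (hEF hn))⟩⟩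
    classical
    exact ⟨Nat.find hex, Nat.find_spec hex, fun m hm => Nat.find_min hex hm⟩
  have hTA : ∀ {n x}, q n x → T n.unpair.1 x ∈ A := fun h => h.1.1 _ (F.refl' _)
  have hTT : ∀ m n x, F' (T n x) (T m x) := fun m n x => F'.trans' (F'.symm' (hTF' n x)) (hTF' m x)
  -- The graph of `σ`: apply the first automorphism, follow `M` to the `E`-class of the second
  -- image, and return by the inverse of the second.
  let R : X → X → Prop := fun x y => (x ∉ Z ∧ x = y) ∨
    (x ∈ Z ∧ E x y ∧ ∃ n, q n x ∧ M (T n.unpair.1 x) (T n.unpair.2 y))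
  have hRe : ∀ x, ∃ y, R x y := by
    intro x
    by_cases hx : x ∈ Z
    · obtain ⟨n, hn⟩ := hqe x hx
      obtain ⟨z, ⟨hz, hz'⟩, -⟩ := hM.existsUnique_mem _ (hTA hn) _ (hTT _ n.unpair.2 x)
      refine ⟨(T n.unpair.2).symm z, Or.inr ⟨hx, ?_, n, hn, ?_⟩⟩
      · rwa [hTE n.unpair.2, Equiv.apply_symm_apply]
      · rwa [Equiv.apply_symm_apply]
    · exact ⟨x, Or.inl ⟨hx, rfl⟩⟩
  have hRu : ∀ x y y', R x y → R x y' → y = y' := by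
    rintro x y y' (⟨hx, rfl⟩ | ⟨hx, hxy, n, hn, h⟩) (⟨hx', rfl⟩ | ⟨hx', hxy', n', hn', h'⟩)
    · rfl
    · exact absurd hx' hx
    · exact absurd hx hx'
    · obtain rfl := hqu (E.refl' x) hn hn'
      obtain ⟨z, -, hz⟩ := hM.existsUnique_mem _ (hTA hn) _ (hTT _ n.unpair.2 x)
      apply (T n.unpair.2).injective
      rw [hz _ ⟨(hTE _ _ _).1 hxy, h⟩, hz _ ⟨(hTE _ _ _).1 hxy', h'⟩]
  choose σ hσ using hRe
  have hσR : ∀ x y, σ x = y ↔ R x y := fun x y =>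
    ⟨fun h => h ▸ hσ x, fun h => hRu x _ _ (hσ x) h⟩
  have hσE : ∀ x, E x (σ x) := by
    intro x
    rcases hσ x with ⟨-, h⟩ | ⟨-, h, -⟩
    · rw [← h]
    · exact h
  have hZE : ∀ {x y}, E x y → x ∈ Z → y ∈ Z := by
    rintro x y h ⟨z, hz, hz'⟩
    have hEF' : F' x y := (hTF x y).2 (by
      obtain ⟨n, hn⟩ := hg 1
      exact ⟨n, by simpa [T, hn] using h⟩)
    exact ⟨z, F'.trans' (F'.symm' hEF') hz, hz'⟩
  refine ⟨σ, measurable_of_measurableSet_graph ?_, ?_, hσE, ?_⟩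
  · simp only [hσR]
    refine ((measurable_fst hZm.compl).inter (measurableSet_eq_fun measurable_fst
      measurable_snd)).union ((measurable_fst hZm).inter (hE.measurableSet_graph.inter
      (measurableSet_exists_countable fun n => (measurable_fst (hqm n)).inter ?_)))
    exact (((hTm _).comp measurable_fst).prodMk ((hTm _).comp measurable_snd))
      hM.measurableSet_graph
  · intro x x' hxx
    have hEx : E x x' := E.trans' (hσE x) (hxx ▸ E.symm' (hσE x'))
    rcases hσ x with ⟨hx, h⟩ | ⟨hx, -, n, hn, h⟩ <;> rcases hσ x' with ⟨hx', h'⟩ | ⟨hx', -, n', hn', h'⟩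
    · rw [h, hxx, ← h']
    · exact absurd (hZE (E.symm' hEx) hx') hx
    · exact absurd (hZE hEx hx) hx'
    · obtain rfl := hqu hEx hn hn'
      rw [← hxx] at h'
      obtain ⟨z, -, hz⟩ := hM.existsUnique_mem _ (hTA hn) _ (F'.refl' _)
      apply (T n.unpair.1).injective
      rw [hz _ ⟨E.refl' _, M.refl' _⟩, hz _ ⟨(hTE _ _ _).1 hEx, M.trans' h (M.symm' h')⟩]
  · intro x hx
    obtain ⟨n, hn⟩ := hqe x hx
    have h2 := hn.1.2
    simp only [Full, not_forall] at h2
    obtain ⟨u, hu, huA⟩ := h2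
    -- The `L`-class of the uncovered point `u` meets the target `E`-class in an uncovered point
    -- `v`. Since `M` preserves `A`, the pullback of `v` is missed by `σ`.
    obtain ⟨v, ⟨hv, huv⟩, -⟩ := hL.existsUnique_mem _ _ hu
    have hvA : v ∉ A := fun h => huA (hMA _ _ (hLM (L.symm' huv)) h)
    have hxb : E x ((T n.unpair.2).symm v) := by rwa [hTE n.unpair.2, Equiv.apply_symm_apply]
    refine ⟨_, hxb, ?_⟩
    rintro ⟨x', hx'⟩
    have hEx : E x x' := E.trans' hxb (hx' ▸ E.symm' (hσE x'))
    rcases hσ x' with ⟨h', -⟩ | ⟨-, -, n', hn', h'⟩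
    · exact h' (hZE hEx hx)
    · obtain rfl := hqu hEx hn hn'
      rw [hx', Equiv.apply_symm_apply] at h'
      exact hvA (hMA _ _ h' (hTA hn'))

/-- From a compression of `E`, a Borel set `B` and for each of its points a sequence in its
`F`-class, such that all these sequences are injective modulo `L` and pairwise disjoint
modulo `L`. -/
theorem exists_disjoint_sequences (hF : IsCBER F) (hEF : E ≤ F) (hLF : L ≤ F)
    {σ : X → X} (hσm : Measurable σ) (hσi : Function.Injective σ) (hσE : ∀ x, E x (σ x))
    {I : ℕ → Set X} (hIm : ∀ j, MeasurableSet (I j))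
    (hIL : ∀ j, ∀ x ∈ I j, ∀ y ∈ I j, L x y → x = y)
    (hIF : ∀ x, ∃ N, ∀ y, F x y → ∃ j < N, y ∈ I j) :
    ∃ (B : Set X) (τ : ℕ → X → X → Prop), MeasurableSet B ∧
      (∀ n, MeasurableSet {p : X × X | τ n p.1 p.2}) ∧
      (∀ n b z, τ n b z → b ∈ B ∧ F b z) ∧ (∀ n b z z', τ n b z → τ n b z' → z = z') ∧
      (∀ n b z n' b' z', τ n b z → τ n' b' z' → L z z' → n = n' ∧ b = b') ∧
      (∀ b ∈ B, ∀ n, ∃ z, τ n b z) ∧ ∀ x, (∃ b, E x b ∧ b ∉ range σ) → ∃ b ∈ B, F x b := by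
  classical
  have hσn : ∀ m, Measurable σ^[m] := fun m => hσm.iterate m
  have hσF : ∀ m x, F x (σ^[m] x) := by
    intro m x
    induction m with
    | zero => exact F.refl' x
    | succ m ih =>
      rw [Function.iterate_succ_apply']
      exact F.trans' ih (hEF (hσE _))
  have hrange : MeasurableSet (range σ) := by
    rw [← image_univ]
    exact MeasurableSet.univ.image_of_measurable_injOn hσm hσi.injOn
  let V : ℕ → X → Prop := fun j b => b ∉ range σ ∧ ∀ n, ∃ m, n ≤ m ∧ σ^[m] b ∈ I j
  have hVm : ∀ j, MeasurableSet {b | V j b} := by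
    intro j
    exact hrange.compl.inter (measurableSet_forall_countable fun n =>
      measurableSet_exists_countable fun m => (MeasurableSet.const _).inter (hσn m (hIm j)))
  -- A single layer, the least one visited infinitely often from outside the range of `σ`, serves
  -- the whole `F`-class. Then `L`-equivalent terms of two sequences lie in one partial transversal
  -- and coincide.
  let J : ℕ → X → Prop := fun j b => V j b ∧ ∀ i, i < j → ¬ ∃ b', F b b' ∧ V i b'
  have hJm : ∀ j, MeasurableSet {b | J j b} := by
    intro j
    exact (hVm j).inter (measurableSet_forall_lt (fun i =>
      (hF.measurableSet_exists_rel measurable_id (R := fun _ b' => V i b')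
        (measurable_snd (hVm i))).compl) j)
  have hJu : ∀ {i j b b'}, F b b' → J i b → J j b' → i = j := by
    intro i j b b' h hi hj
    rcases lt_trichotomy i j with hlt | heq | hlt
    · exact absurd ⟨b, F.symm' h, hi.1⟩ (hj.2 i hlt)
    · exact heq
    · exact absurd ⟨b', h, hj.1⟩ (hi.2 j hlt)
  let c : ℕ → X → ℕ → ℕ := fun j b k => Nat.count (fun m => σ^[m] b ∈ I j) k
  have hcm : ∀ j k, Measurable fun b => c j b k := by
    intro j k
    induction k with
    | zero => exact measurable_const
    | succ k ih =>
      simp only [c, Nat.count_succ]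
      exact ih.add (Measurable.ite (hσn k (hIm j)) measurable_const measurable_const)
  -- `τ n b` is the visit of the `σ`-orbit of `b` to its layer that has exactly `n` earlier visits.
  let τ : ℕ → X → X → Prop := fun n b z =>
    ∃ j k, J j b ∧ σ^[k] b ∈ I j ∧ c j b k = n ∧ σ^[k] b = z
  refine ⟨{b | ∃ j, J j b}, τ, measurableSet_exists_countable hJm, fun n => ?_, ?_, ?_, ?_, ?_, ?_⟩
  · refine measurableSet_exists_countable fun j => measurableSet_exists_countable fun k => ?_
    refine (measurable_fst (hJm j)).inter (((hσn k).comp measurable_fst (hIm j)).inter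
      (((hcm j k).comp measurable_fst (measurableSet_singleton n)).inter ?_))
    exact measurableSet_eq_fun ((hσn k).comp measurable_fst) measurable_snd
  · rintro n b z ⟨j, k, hj, -, -, rfl⟩
    exact ⟨⟨j, hj⟩, hσF k b⟩
  · rintro n b z z' ⟨j, k, hj, hk, hn, rfl⟩ ⟨j', k', hj', hk', hn', rfl⟩
    obtain rfl := hJu (F.refl' b) hj hj'
    rw [Nat.count_injective hk hk' (hn.trans hn'.symm)]
  · rintro n b z n' b' z' ⟨j, k, hj, hk, hn, rfl⟩ ⟨j', k', hj', hk', hn', rfl⟩ hL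
    have hbb : F b b' := F.trans' (hσF k b) (F.trans' (hLF hL) (F.symm' (hσF k' b')))
    obtain rfl := hJu hbb hj hj'
    have heq := hIL j _ hk _ hk' hL
    have key : ∀ {k k' : ℕ} {b b' : X}, b ∉ range σ → σ^[k] b = σ^[k'] b' → ¬ k < k' := by
      intro k k' b b' hb h hlt
      obtain ⟨d, rfl⟩ := Nat.exists_eq_add_of_lt hlt
      rw [add_assoc, Function.iterate_add_apply] at h
      have := hσi.iterate k h
      rw [Function.iterate_succ_apply'] at this
      exact hb ⟨_, this.symm⟩
    obtain rfl : k = k' := le_antisymm (not_lt.1 (key hj'.1.1 heq.symm)) (not_lt.1 (key hj.1.1 heq))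
    obtain rfl := hσi.iterate k heq
    exact ⟨hn.symm.trans hn', rfl⟩
  · rintro b ⟨j, hj⟩ n
    have hinf : {m | σ^[m] b ∈ I j}.Infinite := by
      refine infinite_of_not_bddAbove ?_
      rintro ⟨N, hN⟩
      obtain ⟨m, hm, hm'⟩ := hj.1.2 (N + 1)
      have := hN hm'
      omega
    exact ⟨_, j, Nat.nth (fun m => σ^[m] b ∈ I j) n, hj, Nat.nth_mem_of_infinite hinf n,
      Nat.count_nth_of_infinite hinf n, rfl⟩
  · rintro x ⟨b, hxb, hb⟩
    have hex : ∃ j, ∃ b', F x b' ∧ V j b' := by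
      by_contra hcon
      push Not at hcon
      obtain ⟨N, hN⟩ := hIF b
      have h1 : ∀ j, ∃ n, ∀ m, n ≤ m → σ^[m] b ∉ I j := by
        intro j
        by_contra h
        push Not at h
        exact hcon j b (hEF hxb) ⟨hb, h⟩
      choose n hn using h1
      obtain ⟨j, hj, hjI⟩ := hN (σ^[(Finset.range N).sup n] b) (hσF _ _)
      exact hn j _ (Finset.le_sup (Finset.mem_range.2 hj)) hjI
    obtain ⟨b', hxb', hb'⟩ := Nat.find_spec hex
    refine ⟨b', ⟨Nat.find hex, hb', ?_⟩, hxb'⟩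
    rintro i hi ⟨b'', h, h'⟩
    exact Nat.find_min hex hi ⟨b'', F.trans' hxb' h, h'⟩

end Compression

/-! ### Blocks covering the compressible part -/

section Extension

variable {X : Type*} [MeasurableSpace X] [StandardBorelSpace X] {E F F' L : Setoid X}

/-- A disjoint Borel family of `L`-invariant transversals that are indexed by `L`-classes of their
own `F'`-class, one for each `L`-class in `Z`, can be rearranged to cover `Z`. -/
theorem IsTransversalFamily.exists_cover (hF : IsCBER F) (hF' : IsCBER F') (hL : IsCBER L)
    (hFF' : F ≤ F') (hLF : L ≤ F) {Q Z : Set X} (hQm : MeasurableSet Q)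
    (hQ : ∀ x ∈ Q, ∀ y ∈ Q, L x y → x = y) (hQe : ∀ x, ∃ y ∈ Q, L x y) (hZm : MeasurableSet Z)
    (hZ : ∀ x y, F' x y → x ∈ Z → y ∈ Z) {K : X → X → Prop}
    (hKm : MeasurableSet {p : X × X | K p.1 p.2}) (hK : IsTransversalFamily F F' L K)
    (hKF : ∀ x z, K x z → x ∈ Q ∧ x ∈ Z ∧ F' x z)
    (hKe : ∀ x ∈ Q, x ∈ Z → ∀ y, F' x y → ∃ z, F y z ∧ K x z) :
    ∃ K' : X → X → Prop, MeasurableSet {p : X × X | K' p.1 p.2} ∧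
      IsTransversalFamily F F' L K' ∧ ∀ z ∈ Z, ∃ w, K' w z := by
  -- The Schröder–Bernstein exchange: start from the uncovered points, then pass repeatedly from `x`
  -- to the piece of its block in its own `F`-class. For `x` in the union `R`, `K'` trades that
  -- piece for the `L`-class of `x`.
  let N : ℕ → Set X := fun n => Nat.rec {z | z ∈ Z ∧ ¬ ∃ x, F' z x ∧ K x z}
    (fun _ A => {z | ∃ x, F' z x ∧ x ∈ A ∧ K x z ∧ F x z}) n
  have hN0 : ∀ z, z ∈ N 0 ↔ z ∈ Z ∧ ¬ ∃ x, F' z x ∧ K x z := fun _ => Iff.rfl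
  have hNs : ∀ n z, z ∈ N (n + 1) ↔ ∃ x, F' z x ∧ x ∈ N n ∧ K x z ∧ F x z := fun _ _ => Iff.rfl
  have hNm : ∀ n, MeasurableSet (N n) := by
    intro n
    induction n with
    | zero =>
      exact hZm.inter (hF'.measurableSet_exists_rel measurable_id (R := fun z x => K x z)
        (measurable_swap hKm)).compl
    | succ n ih =>
      exact hF'.measurableSet_exists_rel measurable_id
        (R := fun z x => x ∈ N n ∧ K x z ∧ F x z) ((measurable_snd ih).inter
          ((measurable_swap hKm).inter (hF.measurableSet_rel measurable_snd measurable_fst)))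
  have hNL : ∀ n z z', L z z' → z ∈ N n → z' ∈ N n := by
    intro n z z' h hz
    have h' := hFF' (hLF h)
    cases n with
    | zero =>
      refine ⟨hZ _ _ h' hz.1, ?_⟩
      rintro ⟨x, hx, hxz⟩
      exact hz.2 ⟨x, F'.trans' h' hx, hK.of_rel hxz (L.symm' h)⟩
    | succ n =>
      obtain ⟨x, h1, h2, h3, h4⟩ := hz
      exact ⟨x, F'.trans' (F'.symm' h') h1, h2, hK.of_rel h3 h, F.trans' h4 (hLF h)⟩
  let R : Set X := ⋃ n, N n
  have hRm : MeasurableSet R := MeasurableSet.iUnion hNm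
  have hRL : ∀ {z z'}, L z z' → z ∈ R → z' ∈ R := by
    intro z z' h hz
    obtain ⟨n, hn⟩ := mem_iUnion.1 hz
    exact mem_iUnion.2 ⟨n, hNL n z z' h hn⟩
  have hRK : ∀ {x z}, x ∈ R → K x z → F x z → z ∈ R := by
    intro x z hx h h'
    obtain ⟨n, hn⟩ := mem_iUnion.1 hx
    exact mem_iUnion.2 ⟨n + 1, x, F'.symm' (hFF' h'), hn, h, h'⟩
  have hKR : ∀ {x z}, z ∈ R → K x z → x ∈ R ∧ F x z := by
    intro x z hz h
    obtain ⟨n, hn⟩ := mem_iUnion.1 hz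
    cases n with
    | zero => exact absurd ⟨x, F'.symm' (hKF x z h).2.2, h⟩ hn.2
    | succ n =>
      obtain ⟨x', -, h2, h3, h4⟩ := hn
      obtain rfl := hK.eq_of_mem h3 h
      exact ⟨mem_iUnion.2 ⟨n, h2⟩, h4⟩
  let K' : X → X → Prop := fun x z => x ∈ Q ∧ x ∈ Z ∧
    ((L x z ∧ x ∈ R) ∨ (K x z ∧ ¬ (x ∈ R ∧ F x z)))
  have hK'F : ∀ {x z}, K' x z → F' x z := by
    rintro x z ⟨-, -, ⟨h, -⟩ | ⟨h, -⟩⟩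
    exacts [hFF' (hLF h), (hKF x z h).2.2]
  refine ⟨K', ?_, ⟨?_, ?_, ?_, ?_, ?_⟩, ?_⟩
  · refine (measurable_fst hQm).inter ((measurable_fst hZm).inter (MeasurableSet.union ?_ ?_))
    · exact hL.measurableSet_graph.inter (measurable_fst hRm)
    · exact hKm.inter ((measurable_fst hRm).inter hF.measurableSet_graph).compl
  · rintro x x' z ⟨hx, -, ⟨h1, h2⟩ | ⟨h1, h2⟩⟩ ⟨hx', -, ⟨h3, h4⟩ | ⟨h3, h4⟩⟩
    · exact hQ x hx x' hx' (L.trans' h1 (L.symm' h3))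
    · exact absurd (hKR (hRL h1 h2) h3) h4
    · exact absurd (hKR (hRL h3 h4) h1) h2
    · exact hK.eq_of_mem h1 h3
  · rintro x z z' ⟨hx, hxZ, ⟨h1, h2⟩ | ⟨h1, h2⟩⟩ h
    · exact ⟨hx, hxZ, Or.inl ⟨L.trans' h1 h, h2⟩⟩
    · exact ⟨hx, hxZ, Or.inr ⟨hK.of_rel h1 h, fun h3 =>
        h2 ⟨h3.1, F.trans' h3.2 (F.symm' (hLF h))⟩⟩⟩
  · exact fun h h' => F'.trans' (F'.symm' (hK'F h)) (hK'F h')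
  · rintro x z z' ⟨-, -, ⟨h1, h2⟩ | ⟨h1, h2⟩⟩ ⟨-, -, ⟨h3, h4⟩ | ⟨h3, h4⟩⟩ h
    · exact L.trans' (L.symm' h1) h3
    · exact absurd ⟨h2, F.trans' (hLF h1) h⟩ h4
    · exact absurd ⟨h4, F.trans' (hLF h3) (F.symm' h)⟩ h2
    · exact hK.rel_of_rel h1 h3 h
  · intro x z u hxz hzu
    have hxu : F' x u := F'.trans' (hK'F hxz) hzu
    obtain ⟨hx, hxZ, -⟩ := hxz
    by_cases h : x ∈ R ∧ F x u
    · exact ⟨x, F.symm' h.2, hx, hxZ, Or.inl ⟨L.refl' x, h.1⟩⟩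
    · obtain ⟨z', h1, h2⟩ := hKe x hx hxZ u hxu
      exact ⟨z', h1, hx, hxZ, Or.inr ⟨h2, fun h' => h ⟨h'.1, F.trans' h'.2 (F.symm' h1)⟩⟩⟩
  · intro z hz
    by_cases hzR : z ∈ R
    · obtain ⟨x, hx, h⟩ := hQe z
      exact ⟨x, hx, hZ _ _ (hFF' (hLF h)) hz, Or.inl ⟨L.symm' h, hRL h hzR⟩⟩
    · have hz0 : ∃ x, F' z x ∧ K x z := by
        by_contra h
        exact hzR (mem_iUnion.2 ⟨0, hz, h⟩)
      obtain ⟨x, -, hx⟩ := hz0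
      exact ⟨x, (hKF x z hx).1, (hKF x z hx).2.1, Or.inr ⟨hx, fun h => hzR (hRK h.1 hx h.2)⟩⟩

/-- In each `F`-class the block of `x` takes the term `τ n b`, where `n` is the least index of a
partial injection sending `x` to a point `b` of `B` there. The term determines `n` and `b`, and
these determine `x`, so blocks are disjoint. -/
theorem exists_transversalFamily_of_sequences (hF : IsCBER F) (hF' : IsCBER F') (hL : IsCBER L)
    (hFF' : F ≤ F') (hLF : L ≤ F) {Q Z : Set X} (hQm : MeasurableSet Q)
    (hQ : ∀ x ∈ Q, ∀ y ∈ Q, L x y → x = y) (hQe : ∀ x, ∃ y ∈ Q, L x y) (hZm : MeasurableSet Z)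
    (hZ : ∀ x y, F' x y → x ∈ Z → y ∈ Z) {B : Set X} {τ : ℕ → X → X → Prop}
    (hBm : MeasurableSet B) (hτm : ∀ n, MeasurableSet {p : X × X | τ n p.1 p.2})
    (hτF : ∀ n b z, τ n b z → b ∈ B ∧ F b z) (hτu : ∀ n b z z', τ n b z → τ n b z' → z = z')
    (hτL : ∀ n b z n' b' z', τ n b z → τ n' b' z' → L z z' → n = n' ∧ b = b')
    (hτe : ∀ b ∈ B, ∀ n, ∃ z, τ n b z) (hB : ∀ x ∈ Z, ∃ b ∈ B, F x b) :
    ∃ K : X → X → Prop, MeasurableSet {p : X × X | K p.1 p.2} ∧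
      IsTransversalFamily F F' L K ∧ ∀ z ∈ Z, ∃ w, K w z := by
  obtain ⟨P, hPm, hPF, hPr, hPl⟩ := hF'.exists_partial_injections
  let D : ℕ → X → X → Prop := fun m x b => ∃ b', F b b' ∧ b' ∈ B ∧ P m x b'
  have hDm : ∀ m, MeasurableSet {p : X × X | D m p.1 p.2} := by
    intro m
    refine hF.measurableSet_exists_rel measurable_snd
      (R := fun p b' => b' ∈ B ∧ P m p.1 b') ((measurable_snd hBm).inter ?_)
    exact (by fun_prop : Measurable fun p : (X × X) × X => (p.1.1, p.2)) (hPm m)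
  have hDF : ∀ {m x b c}, F b c → D m x b → D m x c := by
    rintro m x b c h ⟨b', h1, h2⟩
    exact ⟨b', F.trans' (F.symm' h) h1, h2⟩
  let K : X → X → Prop := fun x z => x ∈ Q ∧ x ∈ Z ∧ ∃ n b, F z b ∧ P n x b ∧
    (∀ m, m < n → ¬ D m x b) ∧ ∃ u, L z u ∧ τ n b u
  have hKm : MeasurableSet {p : X × X | K p.1 p.2} := by
    refine (measurable_fst hQm).inter ((measurable_fst hZm).inter
      (measurableSet_exists_countable fun n => ?_))
    have hm : Measurable fun p : (X × X) × X => (p.1.1, p.2) := by fun_prop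
    refine hF.measurableSet_exists_rel measurable_snd (R := fun p b => P n p.1 b ∧
      (∀ m, m < n → ¬ D m p.1 b) ∧ ∃ u, L p.2 u ∧ τ n b u) ?_
    refine (hm (hPm n)).inter (MeasurableSet.inter ?_ ?_)
    · exact hm (measurableSet_forall_lt (fun m => (hDm m).compl) n)
    · refine hL.measurableSet_exists_rel (f := fun p : (X × X) × X => p.1.2)
        (by fun_prop) (R := fun p u => τ n p.2 u) ?_
      exact (by fun_prop : Measurable fun p : ((X × X) × X) × X => (p.1.2, p.2)) (hτm n)
  have hKF : ∀ x z, K x z → x ∈ Q ∧ x ∈ Z ∧ F' x z := by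
    rintro x z ⟨hQx, hZx, n, b, hzb, hP, -⟩
    exact ⟨hQx, hZx, F'.trans' ((hPF x b).2 ⟨n, hP⟩) (F'.symm' (hFF' hzb))⟩
  have hKe : ∀ x ∈ Q, x ∈ Z → ∀ y, F' x y → ∃ z, F y z ∧ K x z := by
    intro x hQx hZx y hxy
    obtain ⟨b₀, hb₀, hyb₀⟩ := hB y (hZ x y hxy hZx)
    obtain ⟨n₀, hn₀⟩ := (hPF x b₀).1 (F'.trans' hxy (hFF' hyb₀))
    have hex : ∃ n, D n x y := ⟨n₀, b₀, hyb₀, hb₀, hn₀⟩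
    classical
    obtain ⟨b, hyb, hb, hP⟩ := Nat.find_spec hex
    obtain ⟨z, hz⟩ := hτe b hb (Nat.find hex)
    have hbz := (hτF _ _ _ hz).2
    refine ⟨z, F.trans' hyb hbz, hQx, hZx, Nat.find hex, b, F.symm' hbz, hP, ?_,
      z, L.refl' z, hz⟩
    exact fun m hm h => Nat.find_min hex hm (hDF (F.symm' hyb) h)
  refine IsTransversalFamily.exists_cover hF hF' hL hFF' hLF hQm hQ hQe hZm hZ hKm
    ⟨?_, ?_, ?_, ?_, ?_⟩ hKF hKe
  · rintro x x' z ⟨-, -, n, b, -, hP, -, u, hu, hτ⟩ ⟨-, -, n', b', -, hP', -, u', hu', hτ'⟩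
    obtain ⟨rfl, rfl⟩ := hτL _ _ _ _ _ _ hτ hτ' (L.trans' (L.symm' hu) hu')
    exact hPl _ _ _ _ hP hP'
  · rintro x z z' ⟨hx, hxZ, n, b, hzb, hP, hmin, u, hu, hτ⟩ h
    exact ⟨hx, hxZ, n, b, F.trans' (F.symm' (hLF h)) hzb, hP, hmin, u,
      L.trans' (L.symm' h) hu, hτ⟩
  · exact fun h h' => F'.trans' (F'.symm' (hKF _ _ h).2.2) (hKF _ _ h').2.2
  · rintro x z z' ⟨-, -, n, b, hzb, hP, hmin, u, hu, hτ⟩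
      ⟨-, -, n', b', hzb', hP', hmin', u', hu', hτ'⟩ h
    have hbb : F b b' := F.trans' (F.symm' hzb) (F.trans' h hzb')
    obtain rfl : n = n' := by
      rcases lt_trichotomy n n' with hlt | heq | hlt
      · exact absurd ⟨b, F.symm' hbb, (hτF _ _ _ hτ).1, hP⟩ (hmin' n hlt)
      · exact heq
      · exact absurd ⟨b', hbb, (hτF _ _ _ hτ').1, hP'⟩ (hmin n' hlt)
    obtain rfl := hPr _ _ _ _ hP hP'
    obtain rfl := hτu _ _ _ _ hτ hτ'
    exact L.trans' hu (L.symm' hu')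
  · intro x z u h hzu
    obtain ⟨hQx, hZx, hxz⟩ := hKF x z h
    exact hKe x hQx hZx u (F'.trans' hxz hzu)

/-- If `E` has finite index and is normal in `F'`, then every `(E, F)`-link with
`E ≤ F ≤ F'` extends to an `(E, F')`-link. -/
theorem exists_link_extension (hE : IsCBER E) (hF : IsCBER F) (hF' : IsCBER F') (hEF : E ≤ F)
    (hFF' : F ≤ F') (hfin : HasFiniteIndexIn E F') (hnorm : IsNormalIn E F')
    (hL : IsLink E F L) : ∃ L' : Setoid X, IsLink E F' L' ∧ L ≤ L' := by
  have hLfin := finite_class_of_link hL hFF' hfin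
  obtain ⟨I, hIm, hIL, hIe, hI0⟩ := hL.isCBER.exists_layers hLfin
  have hfinF : HasFiniteIndexIn F F' := by
    intro x
    have : Quotient.mk F '' {y | F' x y} =
        Quotient.map' (s₁ := E) (s₂ := F) id (fun _ _ h => hEF h) ''
          (Quotient.mk E '' {y | F' x y}) := by
      rw [image_image]
      rfl
    rw [this]
    exact (hfin x).image _
  obtain ⟨K, hKm, hK, hKA⟩ :=
    exists_maximal_transversalFamily hF hF' hL.isCBER hFF' hL.le hLfin hfinF
  obtain ⟨M, hLM, hM, hMK⟩ := hK.exists_link hL hEF hFF' hKm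
  set A : Set X := {z | ∃ w, K w z}
  have hAm : MeasurableSet A := measurableSet_exists (R := fun z w => K w z)
    (measurable_swap hKm) fun z => Set.Subsingleton.countable fun w hw w' hw' => hK.eq_of_mem hw hw'
  obtain ⟨σ, hσm, hσi, hσE, hσZ⟩ := hM.exists_compression hE hF hF' hL hEF hnorm hLM
    (fun x y h ⟨w, hw⟩ => ⟨w, hMK x y h w hw⟩) hAm hKA
  obtain ⟨B, τ, hBm, hτm, hτF, hτu, hτL, hτe, hB⟩ := exists_disjoint_sequences hF hEF hL.le
    hσm hσi hσE hIm hIL (fun x => ⟨(Quotient.mk E '' {y | F' x y}).ncard, fun y hy =>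
      (hIe y).imp fun j hj => ⟨hj.1.trans_le (ncard_class_le hL hFF' hfin (hFF' hy)), hj.2⟩⟩)
  -- The union of the `F'`-classes not fully covered: `M` serves off `Z`, and the compression yields
  -- a new link on `Z`.
  let Z : Set X := {x | ∃ y, F' x y ∧ y ∉ A}
  have hZm : MeasurableSet Z :=
    hF'.measurableSet_exists_rel measurable_id (R := fun _ y => y ∉ A) (measurable_snd hAm.compl)
  have hZ : ∀ x y, F' x y → x ∈ Z → y ∈ Z := by
    rintro x y h ⟨z, hz, hz'⟩
    exact ⟨z, F'.trans' (F'.symm' h) hz, hz'⟩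
  obtain ⟨K', hKm', hK', hKZ'⟩ := exists_transversalFamily_of_sequences hF hF' hL.isCBER hFF' hL.le
    (hIm 0) (hIL 0) hI0 hZm hZ hBm hτm hτF hτu hτL hτe (fun x hx => hB x (hσZ x hx))
  obtain ⟨M', hLM', hM', -⟩ := hK'.exists_link hL hEF hFF' hKm'
  refine IsLinkOn.glue (Z := Z) ⟨hM.measurableSet_graph, hM.le, fun y hy => ?_⟩
    ⟨hM'.measurableSet_graph, hM'.le, fun y hy => hM'.existsUnique_mem y (hKZ' y hy)⟩ hF' hLM hLM'
    hZm hZ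
  refine hM.existsUnique_mem y ?_
  by_contra h
  exact hy ⟨y, F'.refl' y, h⟩

end Extension

/-! ### Outer actions, lifts and links -/

section OuterActions

variable {X : Type*} [MeasurableSpace X] {E : Setoid X}

theorem projOut_eq_iff {S T : autB E} : projOut E S = projOut E T ↔ ∀ x, E (S.1 x) (T.1 x) := by
  rw [QuotientGroup.mk'_apply, QuotientGroup.mk'_apply, QuotientGroup.eq]
  refine forall_congr' fun x => (S.2.2.2 _ _).trans ?_
  change E (S.1 x) (S.1 (S.1.symm (T.1 x))) ↔ _
  rw [Equiv.apply_symm_apply]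

variable {G : Type*} [Group G]

/-- The equivalence relation generated by `E` and an outer action on `X / E`. -/
def outRel (φ : G →* OutB E) : Setoid X where
  r x y := ∃ g, ∃ T : autB E, projOut E T = φ g ∧ E (T.1 x) y
  iseqv :=
    { refl := fun x => ⟨1, 1, by simp, E.refl' x⟩
      symm := by
        rintro x y ⟨g, T, hT, h⟩
        refine ⟨g⁻¹, T⁻¹, by rw [map_inv, map_inv, hT], E.symm' ((T.2.2.2 _ _).2 ?_)⟩
        change E _ (T.1 (T.1.symm y))
        rwa [Equiv.apply_symm_apply]
      trans := by
        rintro x y z ⟨g, T, hT, h⟩ ⟨g', T', hT', h'⟩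
        exact ⟨g' * g, T' * T, by rw [map_mul, map_mul, hT, hT'],
          E.trans' ((T'.2.2.2 _ _).1 h) h'⟩ }

theorem le_outRel (φ : G →* OutB E) : E ≤ outRel φ := fun _ _ h => ⟨1, 1, by simp, h⟩

theorem outRel_comp_le {H : Type*} [Group H] (φ : G →* OutB E) (i : H →* G) :
    outRel (φ.comp i) ≤ outRel φ := by
  rintro x y ⟨h, hx⟩
  exact ⟨i h, hx⟩

theorem outRel_iff {φ : G →* OutB E} {t : G → autB E} (ht : ∀ g, projOut E (t g) = φ g)
    {x y : X} : outRel φ x y ↔ ∃ g, E ((t g).1 x) y := by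
  constructor
  · rintro ⟨g, T, hT, h⟩
    exact ⟨g, E.trans' (projOut_eq_iff.1 ((ht g).trans hT.symm) x) h⟩
  · rintro ⟨g, h⟩
    exact ⟨g, t g, ht g, h⟩

theorem exists_representatives (φ : G →* OutB E) : ∃ t : G → autB E, ∀ g, projOut E (t g) = φ g :=
  ⟨fun g => (QuotientGroup.mk'_surjective _ (φ g)).choose,
    fun g => (QuotientGroup.mk'_surjective _ (φ g)).choose_spec⟩

theorem isCBER_outRel [Countable G] (hE : IsCBER E) (φ : G →* OutB E) : IsCBER (outRel φ) := by
  obtain ⟨t, ht⟩ := exists_representatives φ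
  refine ⟨?_, fun x => ?_⟩
  · simp only [outRel_iff ht]
    exact measurableSet_exists_countable fun g =>
      hE.measurableSet_rel ((t g).2.1.comp measurable_fst) measurable_snd
  · simp only [outRel_iff ht]
    rw [Set.ofPred_exists]
    exact countable_iUnion fun g => hE.countable_class _

/-- Chosen representatives need not be closed under products, so the countable subgroup is the image
of the free group on `G`. -/
theorem isNormalIn_outRel [Countable G] (φ : G →* OutB E) : IsNormalIn E (outRel φ) := by
  obtain ⟨t, ht⟩ := exists_representatives φ
  have hφ : (projOut E).comp (FreeGroup.lift t) = φ.comp (FreeGroup.lift id) := by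
    ext g
    simpa using ht g
  refine ⟨(FreeGroup.lift t).range, (countable_range (FreeGroup.lift t)).to_subtype, fun x y => ?_⟩
  rw [outRel_iff ht]
  constructor
  · rintro ⟨g, h⟩
    exact ⟨t g, ⟨FreeGroup.of g, by simp⟩, h⟩
  · rintro ⟨_, ⟨w, rfl⟩, h⟩
    exact (outRel_iff ht).1 ⟨_, _, DFunLike.congr_fun hφ w, h⟩

theorem hasFiniteIndexIn_outRel [Finite G] (φ : G →* OutB E) : HasFiniteIndexIn E (outRel φ) := by
  obtain ⟨t, ht⟩ := exists_representatives φ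
  intro x
  refine (finite_range fun g => Quotient.mk E ((t g).1 x)).subset ?_
  rintro _ ⟨y, hy, rfl⟩
  obtain ⟨g, hg⟩ := (outRel_iff ht).1 hy
  exact ⟨g, Quotient.sound hg⟩

/-- A link for an outer action yields a class-bijective lift moving points along the link. -/
theorem exists_lift_of_link [StandardBorelSpace X] (hE : IsCBER E) (φ : G →* OutB E)
    {L : Setoid X} (hL : IsLink E (outRel φ) L) :
    ∃ ψ : G →* autB E, IsLift ψ φ ∧ IsClassBijective ψ ∧ ∀ g x, L x ((ψ g).1 x) := by
  obtain ⟨t, ht⟩ := exists_representatives φ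
  have hex : ∀ g x, ∃ z, E ((t g).1 x) z ∧ L x z := fun g x =>
    (hL.existsUnique_mem _ x ((outRel φ).symm' ((outRel_iff ht).2 ⟨g, E.refl' _⟩))).exists
  choose s hsE hsL using hex
  have hmul : ∀ g h x, s (g * h) x = s g (s h x) := by
    intro g h x
    -- Both points are linked to `x` and lie in the `E`-class prescribed by `φ (g * h)`.
    refine hL.eq_of_rel (E.trans' (E.symm' (hsE _ x)) (E.trans' ?_ (hsE g _)))
      (L.trans' (L.symm' (hsL _ x)) (L.trans' (hsL h x) (hsL g _)))
    have h1 : projOut E (t (g * h)) = projOut E (t g * t h) := by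
      rw [map_mul, ht, ht, ht, map_mul]
    exact E.trans' (projOut_eq_iff.1 h1 x) (((t g).2.2.2 _ _).1 (hsE h x))
  have hone : ∀ x, s 1 x = x := by
    intro x
    have h1 : projOut E (t 1) = projOut E 1 := by rw [ht, map_one, map_one]
    exact hL.eq_of_rel (E.trans' (E.symm' (hsE 1 x)) (projOut_eq_iff.1 h1 x)) (L.symm' (hsL 1 x))
  have hsm : ∀ g, Measurable (s g) := by
    intro g
    refine measurable_of_measurableSet_graph ?_
    convert (hE.measurableSet_rel ((t g).2.1.comp measurable_fst) measurable_snd).inter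
      hL.isCBER.measurableSet_graph using 1
    ext ⟨x, y⟩
    constructor
    · intro h
      obtain rfl : s g x = y := h
      exact ⟨hsE g x, hsL g x⟩
    · rintro ⟨h, h'⟩
      exact hL.eq_of_rel (E.trans' (E.symm' (hsE g x)) h) (L.trans' (L.symm' (hsL g x)) h')
  let σ : G → Equiv.Perm X := fun g =>
    { toFun := s g
      invFun := s g⁻¹
      left_inv := fun x => by rw [← hmul, inv_mul_cancel, hone]
      right_inv := fun x => by rw [← hmul, mul_inv_cancel, hone] }
  have hσ : ∀ g, σ g ∈ autB E := fun g => ⟨hsm g, hsm g⁻¹, fun x y => by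
    rw [(t g).2.2.2 x y]
    exact ⟨fun h => E.trans' (E.symm' (hsE g x)) (E.trans' h (hsE g y)),
      fun h => E.trans' (hsE g x) (E.trans' h (E.symm' (hsE g y)))⟩⟩
  let ψ : G →* autB E := MonoidHom.mk' (fun g => ⟨σ g, hσ g⟩) fun g h =>
    Subtype.ext (Equiv.ext fun x => hmul g h x)
  refine ⟨ψ, MonoidHom.ext fun g => ?_, fun g x h => ?_, hsL⟩
  · rw [← ht g]
    exact projOut_eq_iff.2 fun x => E.symm' (hsE g x)
  · exact hL.eq_of_rel h (L.symm' (hsL g x))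

/-- The orbit equivalence relation of an action by automorphisms of `E`. -/
def orbitRel (η : G →* autB E) : Setoid X where
  r x y := ∃ g, (η g).1 x = y
  iseqv :=
    { refl := fun x => ⟨1, by simp⟩
      symm := by
        rintro x _ ⟨g, rfl⟩
        refine ⟨g⁻¹, ?_⟩
        rw [map_inv]
        exact (η g).1.symm_apply_apply x
      trans := by
        rintro x _ _ ⟨g, rfl⟩ ⟨h, rfl⟩
        exact ⟨h * g, by rw [map_mul]; rfl⟩ }

/-- Lifting makes every orbit meet each `E`-class of its `outRel φ`-class; class-bijectivity makes
it meet it only once. -/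
theorem isLink_orbitRel [StandardBorelSpace X] [Countable G] {η : G →* autB E} {φ : G →* OutB E}
    (hη : IsLift η φ) (hcb : IsClassBijective η) : IsLink E (outRel φ) (orbitRel η) := by
  have ht : ∀ g, projOut E (η g) = φ g := fun g => DFunLike.congr_fun hη g
  refine ⟨⟨?_, fun x => ?_⟩, ?_, fun x y hxy => ?_⟩
  · exact measurableSet_exists_countable fun g =>
      measurableSet_eq_fun ((η g).2.1.comp measurable_fst) measurable_snd
  · exact countable_range fun g => (η g).1 x
  · rintro x _ ⟨g, rfl⟩
    exact (outRel_iff ht).2 ⟨g, E.refl' _⟩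
  · obtain ⟨g, hg⟩ := (outRel_iff ht).1 ((outRel φ).symm' hxy)
    refine ⟨(η g).1 y, ⟨E.symm' hg, g, rfl⟩, ?_⟩
    rintro _ ⟨h1, h, rfl⟩
    obtain ⟨k, hk⟩ : orbitRel η ((η g).1 y) ((η h).1 y) :=
      (orbitRel η).trans' ((orbitRel η).symm' ⟨g, rfl⟩) ⟨h, rfl⟩
    rw [← hk] at h1 ⊢
    exact hcb k _ (E.symm' (E.trans' hg h1))

end OuterActions

/-! ### The lifting theorems -/

theorem hasClassBijectiveLifting_of_finite {H : Type v} {G : Type w} [Group H] [Group G] [Finite H]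
    [Finite G] (i : H →* G) : HasClassBijectiveLifting.{u} i := by
  intro X _ _ E hE η φ hηφ hη
  obtain ⟨L, hL, hLη⟩ := exists_link_extension hE (isCBER_outRel hE (φ.comp i))
    (isCBER_outRel hE φ) (le_outRel _) (outRel_comp_le φ i) (hasFiniteIndexIn_outRel φ)
    (isNormalIn_outRel φ) (isLink_orbitRel hηφ hη)
  obtain ⟨ψ, hψ, hψc, hψL⟩ := exists_lift_of_link hE φ hL
  refine ⟨ψ, hψ, MonoidHom.ext fun h => Subtype.ext (Equiv.ext fun x => ?_), hψc⟩
  -- `ψ (i h)` and `η h` send `x` into one `E`-class and along one link, which contains the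
  -- `η`-orbits.
  refine hL.eq_of_rel (projOut_eq_iff.1 ?_ x) (L.trans' (L.symm' (hψL (i h) x)) (hLη ⟨h, rfl⟩))
  exact (DFunLike.congr_fun hψ (i h)).trans (DFunLike.congr_fun hηφ h).symm

theorem isLink_bot {X : Type*} [MeasurableSpace X] [StandardBorelSpace X] (E : Setoid X) :
    IsLink E E ⊥ := by
  refine ⟨⟨measurableSet_eq_fun measurable_fst measurable_snd, fun x => ?_⟩, bot_le,
    fun x y h => ⟨y, ⟨h, rfl⟩, fun z hz => hz.2.symm⟩⟩
  exact (countable_singleton x).mono fun y hy => Eq.symm hy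

theorem exists_lift_of_isLocallyFiniteGroup {G : Type v} [Group G] [Countable G]
    (hG : IsLocallyFiniteGroup G) {X : Type u} [MeasurableSpace X] [StandardBorelSpace X]
    {E : Setoid X} (hE : IsCBER E) (φ : G →* OutB E) :
    ∃ ψ : G →* autB E, IsLift ψ φ ∧ IsClassBijective ψ := by
  obtain ⟨e, he⟩ := exists_surjective_nat G
  let K : ℕ → Subgroup G := fun n => Subgroup.closure (e '' Iio n)
  have hKmono : Monotone K := fun m n h =>
    Subgroup.closure_mono (image_mono (Iio_subset_Iio h))
  have hKfin : ∀ n, Finite (K n) := fun n =>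
    hG _ ((Subgroup.fg_iff _).2 ⟨_, rfl, (finite_Iio n).image e⟩)
  let F : ℕ → Setoid X := fun n => outRel (φ.comp (K n).subtype)
  have hF : ∀ n, IsCBER (F n) := fun n => isCBER_outRel hE _
  have hFm : ∀ n, F n ≤ F (n + 1) := by
    rintro n x y ⟨g, hx⟩
    exact ⟨⟨g.1, hKmono (Nat.le_succ n) g.2⟩, hx⟩
  let S := fun n => {L : Setoid X // IsLink E (F n) L}
  have h0 : Nonempty (S 0) := by
    obtain ⟨L, hL, -⟩ := exists_link_extension hE hE (hF 0) le_rfl (le_outRel _)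
      (hasFiniteIndexIn_outRel _) (isNormalIn_outRel _) (isLink_bot E)
    exact ⟨L, hL⟩
  have hs : ∀ n (L : S n), ∃ L' : S (n + 1), L.1 ≤ L'.1 := by
    rintro n ⟨L, hL⟩
    obtain ⟨L', hL', h⟩ := exists_link_extension hE (hF n) (hF (n + 1)) (le_outRel _) (hFm n)
      (hasFiniteIndexIn_outRel _) (isNormalIn_outRel _) hL
    exact ⟨⟨L', hL'⟩, h⟩
  choose next hnext using hs
  obtain ⟨T, hT⟩ : ∃ T : ∀ n, S n, Monotone fun n => (T n).1 :=
    ⟨fun n => Nat.rec (motive := S) h0.some next n, monotone_nat_of_le_succ fun n => hnext n _⟩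
  let L : Setoid X :=
    { r := fun x y => ∃ n, (T n).1 x y
      iseqv :=
        { refl := fun x => ⟨0, (T 0).1.refl' x⟩
          symm := fun ⟨n, h⟩ => ⟨n, (T n).1.symm' h⟩
          trans := fun ⟨n, h⟩ ⟨m, h'⟩ => ⟨max n m, (T (max n m)).1.trans' (hT (le_max_left n m) h)
            (hT (le_max_right n m) h')⟩ } }
  have hFφ : ∀ n, F n ≤ outRel φ := fun n => outRel_comp_le φ _
  have hLφ : L ≤ outRel φ := by
    rintro x y ⟨n, h⟩
    exact hFφ n ((T n).2.le h)
  have hL : IsLink E (outRel φ) L := by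
    refine ⟨⟨measurableSet_exists_countable fun n => (T n).2.isCBER.measurableSet_graph,
      fun x => ((isCBER_outRel hE φ).countable_class x).mono fun y hy => hLφ hy⟩, hLφ, ?_⟩
    rintro x y ⟨g, hg⟩
    obtain ⟨n, rfl⟩ := he g
    -- `K n` is generated by the values of `e` strictly below `n`, so `e n` first surely appears in
    -- `K (n + 1)`.
    have hxy : F (n + 1) x y :=
      ⟨⟨e n, Subgroup.subset_closure ⟨n, Nat.lt_succ_self n, rfl⟩⟩, hg⟩
    obtain ⟨z, ⟨hz, hz'⟩, -⟩ := (T (n + 1)).2.existsUnique_mem x y hxy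
    refine ⟨z, ⟨hz, n + 1, hz'⟩, ?_⟩
    rintro w ⟨hw, m, hw'⟩
    refine (T (max m (n + 1))).2.eq_of_rel (E.trans' (E.symm' hw) hz) ?_
    exact (T _).1.trans' ((T _).1.symm' (hT (le_max_left _ _) hw')) (hT (le_max_right _ _) hz')
  obtain ⟨ψ, h1, h2, -⟩ := exists_lift_of_link hE φ hL
  exact ⟨ψ, h1, h2⟩

end CBER

theorem mainTheorem9 :
    (∀ (X : Type u) [MeasurableSpace X] [StandardBorelSpace X] (E F F' : Setoid X),
      CBER.IsCBER E → CBER.IsCBER F → CBER.IsCBER F' → E ≤ F → F ≤ F' →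
      CBER.HasFiniteIndexIn E F' → CBER.IsNormalIn E F' →
      ∀ L : Setoid X, CBER.IsLink E F L → ∃ L' : Setoid X, CBER.IsLink E F' L' ∧ L ≤ L') ∧
    (∀ (H : Type v) (G : Type w) [Group H] [Group G] [Finite H] [Finite G] (i : H →* G),
      CBER.HasClassBijectiveLifting.{u} i) ∧
    (∀ (G : Type v) [Group G] [Countable G], CBER.IsLocallyFiniteGroup G →
      ∀ (X : Type u) [MeasurableSpace X] [StandardBorelSpace X] (E : Setoid X), CBER.IsCBER E →
      ∀ φ : G →* CBER.OutB E,
        ∃ ψ : G →* CBER.autB E, CBER.IsLift ψ φ ∧ CBER.IsClassBijective ψ) :=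
  ⟨fun _ _ _ _ _ _ hE hF hF' hEF hFF' hfin hnorm _ hL =>
      CBER.exists_link_extension hE hF hF' hEF hFF' hfin hnorm hL,
    fun _ _ _ _ _ _ i => CBER.hasClassBijectiveLifting_of_finite i,
    fun _ _ _ hG _ _ _ _ hE φ => CBER.exists_lift_of_isLocallyFiniteGroup hG hE φ⟩
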